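/- Let $G$ be a finite group and let $L$ be an irreducible $G$-lattice, i.e. a finitely generated free abelian group with a linear action of $G$ such that $L^{\mathbb Q}:=\mathbb Q\otimes_{\mathbb Z}L$ is an irreducible $\mathbb QG$-module. For $K\in\{\mathbb Z,\mathbb Q\}$, a $KG$-module $V$ is called essentially complex if there is an $\mathbb R G$-endomorphism $J$ of $\mathbb R\otimes_K V$ with $J^2=-\mathrm{id}$. Let $\chi_L$ be the character of $L$, let $\chi_s$ be a complex irreducible character of $G$ with $(\chi_L,\chi_s)\neq 0$, and let $\nu_2(\chi_s)=\frac1{|G|}\sum_{g\in G}\chi_s(g^2)$ be its Frobenius–Schur indicator. The lattice $L$ is of complex type if $\nu_2(\chi_s)=0$ and of quaternionic type if $\nu_2(\chi_s)=-1$. Its Schur index is $m(L):=m_{\mathbb Q}(\chi_s)$, the least integer $m\geq 1$ such that $m\chi_s$ is the character of a representation of $G$ over the field $\mathbb Q(\chi_s)$ generated by the values of $\chi_s$. (None of these depends on the choice of $\chi_s$.) Then the following are equivalent: 1. $L$ is essentially complex. 2. $L^{\mathbb Q}$ is essentially complex. 3. $L$ is of complex type, or $L$ is of quaternionic type, or $m(L)$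 is even. -/

import Mathlib

open scoped TensorProduct

namespace GLattice

noncomputable section

/-- Extension of scalars of a linear representation: `G` acts on `A ⊗[K] V`
through the second factor. -/
def baseChange {K : Type*} [CommRing K] {G : Type*} [Group G] {V : Type*} [AddCommGroup V]
    [Module K V] (A : Type*) [CommRing A] [Algebra K A] (ρ : Representation K G V) :
    Representation A G (A ⊗[K] V) where
  toFun g := (ρ g).baseChange A
  map_one' := by rw [map_one]; exact LinearMap.baseChange_one ..
  map_mul' g h := by rw [map_mul]; exact LinearMap.baseChange_mul (ρ g) (ρ h)

/-- A complex structure on a `K G`-module `V` (in practice `K` is `ℤ`, `ℚ` or `ℝ`): an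
`ℝ G`-endomorphism `J` of `ℝ ⊗[K] V` with `J ∘ J = -id`. -/
structure IsComplexStructure {K : Type*} [CommRing K] [Algebra K ℝ] {G : Type*} [Group G]
    {V : Type*} [AddCommGroup V] [Module K V] (ρ : Representation K G V)
    (J : (ℝ ⊗[K] V) →ₗ[ℝ] (ℝ ⊗[K] V)) : Prop where
  commutes : ∀ (g : G) (x : ℝ ⊗[K] V), J (baseChange ℝ ρ g x) = baseChange ℝ ρ g (J x)
  sq_eq : ∀ x : ℝ ⊗[K] V, J (J x) = -x

/-- A module is essentially complex if it admits a complex structure. -/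
def IsEssentiallyComplex {K : Type*} [CommRing K] [Algebra K ℝ] {G : Type*} [Group G]
    {V : Type*} [AddCommGroup V] [Module K V] (ρ : Representation K G V) : Prop :=
  ∃ J : (ℝ ⊗[K] V) →ₗ[ℝ] (ℝ ⊗[K] V), IsComplexStructure ρ J

/-- The set `Irr(G)` of complex irreducible characters of `G`. -/
def Irr (G : Type*) [Group G] : Set (G → ℂ) :=
  {χ | ∃ (n : ℕ) (σ : Representation ℂ G (Fin n → ℂ)), σ.IsIrreducible ∧ χ = σ.character}

/-- The usual inner product of complex valued functions on a finite group. -/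
def charInner {G : Type*} [Group G] [Fintype G] (φ ψ : G → ℂ) : ℂ :=
  (Fintype.card G : ℂ)⁻¹ * ∑ g : G, φ g * starRingEnd ℂ (ψ g)

/-- The Frobenius-Schur indicator `ν₂(χ)`. -/
def frobeniusSchur {G : Type*} [Group G] [Fintype G] (χ : G → ℂ) : ℂ :=
  (Fintype.card G : ℂ)⁻¹ * ∑ g : G, χ (g ^ 2)

/-- The character `χ_V` of a `K G`-module `V` that is finitely generated and free over `K`,
with values viewed in `ℂ`. -/
def character {K : Type*} [CommRing K] [Algebra K ℂ] {G : Type*} [Group G]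
    {V : Type*} [AddCommGroup V] [Module K V] (ρ : Representation K G V) (g : G) : ℂ :=
  algebraMap K ℂ (LinearMap.trace K V (ρ g))

/-- The set of `χ ∈ Irr(G)` with `(χ_V, χ) ≠ 0`. -/
def constituents {K : Type*} [CommRing K] [Algebra K ℂ] {G : Type*} [Group G] [Fintype G]
    {V : Type*} [AddCommGroup V] [Module K V] (ρ : Representation K G V) : Set (G → ℂ) :=
  {χ | χ ∈ Irr G ∧ charInner (character ρ) χ ≠ 0}

/-- The irreducible constituents of the character of `V` (and there are some) have
Frobenius-Schur indicator `ε`. -/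
def HasIndicator {K : Type*} [CommRing K] [Algebra K ℂ] {G : Type*} [Group G] [Fintype G]
    {V : Type*} [AddCommGroup V] [Module K V] (ρ : Representation K G V) (ε : ℂ) : Prop :=
  (constituents ρ).Nonempty ∧ ∀ χ ∈ constituents ρ, frobeniusSchur χ = ε

/-- `V` is of complex type. -/
def IsOfComplexType {K : Type*} [CommRing K] [Algebra K ℂ] {G : Type*} [Group G] [Fintype G]
    {V : Type*} [AddCommGroup V] [Module K V] (ρ : Representation K G V) : Prop :=
  HasIndicator ρ 0

/-- `V` is of quaternionic type. -/
def IsOfQuaternionicType {K : Type*} [CommRing K] [Algebra K ℂ] {G : Type*} [Group G]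
    [Fintype G] {V : Type*} [AddCommGroup V] [Module K V] (ρ : Representation K G V) : Prop :=
  HasIndicator ρ (-1)

/-- The field `ℚ(χ)` generated over `ℚ` by the values of `χ`. -/
abbrev characterField {G : Type*} (χ : G → ℂ) : IntermediateField ℚ ℂ :=
  IntermediateField.adjoin ℚ (Set.range χ)

/-- The Schur index `m_ℚ(χ)` of an irreducible character over the rationals: the least positive
integer `m` such that `m χ` is the character of a representation over `ℚ(χ)`. -/
def schurIndex {G : Type*} [Group G] (χ : G → ℂ) : ℕ :=
  sInf {m : ℕ | 0 < m ∧ ∃ (n : ℕ)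
    (σ : Representation (characterField χ) G (Fin n → characterField χ)),
      ∀ g : G, ((σ.character g : characterField χ) : ℂ) = m * χ g}

open Classical in
/-- The Schur index `m(V) = m_ℚ(χ_s)` of an irreducible `ℚ G`-module `V`, where `χ_s` is any
irreducible constituent of the character of `V`. -/
def moduleSchurIndex {G : Type*} [Group G] [Fintype G] {V : Type*} [AddCommGroup V]
    [Module ℚ V] (ρ : Representation ℚ G V) : ℕ :=
  if h : (constituents ρ).Nonempty then schurIndex h.some else 0

/-- The Schur index `m(L) = m(ℚ ⊗ L)` of an irreducible `G`-lattice `L`. -/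
def latticeSchurIndex {G : Type*} [Group G] [Fintype G] {L : Type*} [AddCommGroup L]
    (ρ : Representation ℤ G L) : ℕ :=
  moduleSchurIndex (baseChange ℚ ρ)

/-- A `G`-lattice `L` is irreducible if `ℚ ⊗ L` is an irreducible `ℚ G`-module. -/
def IsIrreducibleLattice {G : Type*} [Group G] {L : Type*} [AddCommGroup L]
    (ρ : Representation ℤ G L) : Prop :=
  (baseChange ℚ ρ).IsIrreducible

end

end GLattice

/-! Statements 1 and 2 concern the same real character, that of `L`, so it suffices to decide from
its character when a real representation `V` has an equivariant `J` with `J² = -1`. The criterion is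
that every absolutely irreducible real constituent has even multiplicity. If `J` exists, it acts on
the space of maps from a real irreducible `S` to `V`, which therefore has even dimension.
Conversely, an irreducible `S` either carries a `J` itself or has only scalar endomorphisms; in the
second case even multiplicity allows copies to be paired, and `S ⊕ S` carries `(a, b) ↦ (-b, a)`.
See `hasComplexStructure_of_hasEvenRealMultiplicities`.

On the complex side, `real_or_frobeniusSchur` shows that an irreducible `χ` is afforded by an
absolutely irreducible real representation unless its indicator is `0` or `-1`. For an irreducible
rational representation, all constituents are conjugate under ring endomorphisms of `ℂ`, so they
share indicator and multiplicity, and that multiplicity is the Schur index. Indeed the `χ`-isotypic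
part over `ℚ(χ)` affords that multiple of `χ`. Conversely, any representation over `ℚ(χ)` affording
`m χ`, viewed over `ℚ`, contains the given irreducible one, which bounds the multiplicity by `m`.

The criterion thus says that the common indicator is `0` or `-1`, or else the Schur index is even.
-/

namespace GLattice

open Representation

/-! ### The character pairing over an arbitrary field. -/

section Pairing

variable {G : Type*} [Group G] [Fintype G] {k : Type*} [Field k]

/-- The bilinear pairing `|G|⁻¹ ∑ φ(g) ψ(g⁻¹)` of functions on a finite group. -/
noncomputable def pairing (φ ψ : G → k) : k :=
  (Nat.card G : k)⁻¹ * ∑ g : G, φ g * ψ g⁻¹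

lemma pairing_comm (φ ψ : G → k) : pairing φ ψ = pairing ψ φ := by
  unfold pairing
  congr 1
  refine Fintype.sum_equiv (Equiv.inv G) _ _ fun g => ?_
  simp [mul_comm]

lemma pairing_add_left (φ φ' ψ : G → k) :
    pairing (φ + φ') ψ = pairing φ ψ + pairing φ' ψ := by
  simp [pairing, add_mul, Finset.sum_add_distrib, mul_add]

lemma pairing_add_right (φ ψ ψ' : G → k) :
    pairing φ (ψ + ψ') = pairing φ ψ + pairing φ ψ' := by
  rw [pairing_comm, pairing_add_left, pairing_comm ψ, pairing_comm ψ']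

lemma pairing_smul_left (c : k) (φ ψ : G → k) : pairing (c • φ) ψ = c * pairing φ ψ := by
  simp only [pairing, Pi.smul_apply, smul_eq_mul, Finset.mul_sum]
  exact Finset.sum_congr rfl fun g _ => by ring

lemma pairing_sum_left {ι : Type*} (s : Finset ι) (φ : ι → G → k) (ψ : G → k) :
    pairing (∑ i ∈ s, φ i) ψ = ∑ i ∈ s, pairing (φ i) ψ := by
  classical
  induction s using Finset.induction with
  | empty => simp [pairing]
  | insert i s hi ih => rw [Finset.sum_insert hi, Finset.sum_insert hi, pairing_add_left, ih]

lemma map_pairing {K : Type*} [Field K] (f : k →+* K) (φ ψ : G → k) :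
    f (pairing φ ψ) = pairing (f ∘ φ) (f ∘ ψ) := by
  simp [pairing]

end Pairing

/-! ### Irreducibility, matrix forms and complete reducibility. -/

section Generalities

variable {G : Type*} [Group G] {k : Type*} [Field k]
  {V W : Type*} [AddCommGroup V] [Module k V] [AddCommGroup W] [Module k W]

lemma isIrreducible_iff (ρ : Representation k G V) :
    ρ.IsIrreducible ↔ Nontrivial V ∧
      ∀ p : Submodule k V, (∀ g, ∀ v ∈ p, ρ g v ∈ p) → p = ⊥ ∨ p = ⊤ := by
  constructor
  · intro h
    refine ⟨?_, fun p hp => ?_⟩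
    · by_contra hV
      rw [not_nontrivial_iff_subsingleton] at hV
      obtain ⟨a, b, hab⟩ := h.exists_pair_ne
      exact hab (Subrepresentation.toSubmodule_injective (Subsingleton.elim _ _))
    · rcases h.eq_bot_or_eq_top ⟨p, fun g v hv => hp g v hv⟩ with h | h
      · exact .inl (congrArg Subrepresentation.toSubmodule h)
      · exact .inr (congrArg Subrepresentation.toSubmodule h)
  · rintro ⟨hV, h⟩
    refine { exists_pair_ne := ⟨⊥, ⊤, fun hbt => ?_⟩, eq_bot_or_eq_top := fun p => ?_ }
    · exact bot_ne_top (α := Submodule k V) (congrArg Subrepresentation.toSubmodule hbt)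
    · rcases h p.toSubmodule (fun g v hv => p.apply_mem_toSubmodule g hv) with h | h
      · exact .inl (Subrepresentation.toSubmodule_injective h)
      · exact .inr (Subrepresentation.toSubmodule_injective h)

lemma isIrreducible_of_equiv {ρ : Representation k G V} {σ : Representation k G W}
    (e : Equiv ρ σ) (h : ρ.IsIrreducible) : σ.IsIrreducible := by
  have he (g : G) (v : V) : e.toLinearEquiv (ρ g v) = σ g (e.toLinearEquiv v) :=
    IntertwiningMap.isIntertwining _ _ e.toIntertwiningMap g v
  generalize e.toLinearEquiv = e' at he
  rw [isIrreducible_iff] at h ⊢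
  obtain ⟨h1, h2⟩ := h
  refine ⟨e'.symm.toEquiv.nontrivial, fun p hp => ?_⟩
  have hmap : (p.comap e'.toLinearMap).map e'.toLinearMap = p :=
    Submodule.map_comap_eq_of_surjective e'.surjective p
  rcases h2 (p.comap e'.toLinearMap) (fun g v hv => by
    change e' (ρ g v) ∈ p
    exact he g v ▸ hp g _ hv) with h | h
  · left
    rw [← hmap, h, Submodule.map_bot]
  · right
    rw [← hmap, h, Submodule.map_top, LinearEquiv.range]

lemma character_prod [FiniteDimensional k V] [FiniteDimensional k W]
    (ρ : Representation k G V) (σ : Representation k G W) :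
    (ρ.prod σ).character = ρ.character + σ.character := by
  ext g
  exact LinearMap.trace_prodMap' (ρ g) (σ g)

/-- The representation on column vectors given by a matrix representation. -/
noncomputable def ofMatrix {n : Type*} [Fintype n] [DecidableEq n] (R : G →* Matrix n n k) :
    Representation k G (n → k) :=
  (Matrix.toLinAlgEquiv' (R := k) (n := n)).toRingEquiv.toMonoidHom.comp R

@[simp]
lemma ofMatrix_apply {n : Type*} [Fintype n] [DecidableEq n] (R : G →* Matrix n n k) (g : G)
    (v : n → k) : ofMatrix R g v = (R g).mulVec v := rfl

lemma ofMatrix_character {n : Type*} [Fintype n] [DecidableEq n] (R : G →* Matrix n n k) (g : G) :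
    (ofMatrix R).character g = (R g).trace :=
  Matrix.trace_toLin'_eq (R g)

/-- The matrices of a representation in a basis. -/
noncomputable def toMatrixHom {n : Type*} [Fintype n] [DecidableEq n] (b : Module.Basis n k V)
    (ρ : Representation k G V) : G →* Matrix n n k :=
  (LinearMap.toMatrixAlgEquiv b).toRingEquiv.toMonoidHom.comp ρ

lemma toMatrixHom_apply {n : Type*} [Fintype n] [DecidableEq n] (b : Module.Basis n k V)
    (ρ : Representation k G V) (g : G) : toMatrixHom b ρ g = LinearMap.toMatrix b b (ρ g) := rfl

/-- A representation is equivalent to the one given by its matrices. -/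
noncomputable def equivOfMatrix {n : Type*} [Fintype n] [DecidableEq n] (b : Module.Basis n k V)
    (ρ : Representation k G V) : Equiv ρ (ofMatrix (toMatrixHom b ρ)) :=
  .mk b.equivFun fun g => by
    ext v i
    simp [toMatrixHom_apply, ← LinearMap.toMatrix_mulVec_repr b b (ρ g) v]

lemma exists_equiv_fin [FiniteDimensional k V] (ρ : Representation k G V) :
    ∃ (n : ℕ) (σ : Representation k G (Fin n → k)), Nonempty (Equiv ρ σ) :=
  ⟨_, _, ⟨equivOfMatrix (Module.finBasis k V) ρ⟩⟩

/-- Transport of a representation along a homomorphism of fields. -/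
lemma exists_character_eq_comp {K : Type*} [Field K] (f : k →+* K) [FiniteDimensional k V]
    (ρ : Representation k G V) :
    ∃ (n : ℕ) (σ : Representation K G (Fin n → K)), σ.character = f ∘ ρ.character := by
  refine ⟨_, ofMatrix (f.mapMatrix.toMonoidHom.comp (toMatrixHom (Module.finBasis k V) ρ)), ?_⟩
  ext g
  rw [ofMatrix_character, Function.comp_apply, Representation.character,
    LinearMap.trace_eq_matrix_trace k (Module.finBasis k V)]
  simp [toMatrixHom_apply, Matrix.trace]

lemma exists_irreducible_subrepresentation [FiniteDimensional k V] [Nontrivial V]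
    (ρ : Representation k G V) :
    ∃ S : Subrepresentation ρ, S.toRepresentation.IsIrreducible := by
  have : WellFoundedLT (Subrepresentation ρ) :=
    ⟨InvImage.wf Subrepresentation.toSubmodule (wellFounded_lt (α := Submodule k V))⟩
  have : IsAtomic (Subrepresentation ρ) := isAtomic_of_orderBot_wellFounded_lt wellFounded_lt
  have : Nontrivial (Subrepresentation ρ) :=
    ⟨⊥, ⊤, fun h => bot_ne_top (α := Submodule k V) (congrArg Subrepresentation.toSubmodule h)⟩
  obtain ⟨S, hS, -⟩ := (eq_bot_or_exists_atom_le (⊤ : Subrepresentation ρ)).resolve_left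
    bot_ne_top.symm
  refine ⟨S, (isIrreducible_iff _).2 ⟨?_, fun p hp => ?_⟩⟩
  · rw [Submodule.nontrivial_iff_ne_bot]
    exact fun h => hS.1 (Subrepresentation.toSubmodule_injective h)
  · let P : Subrepresentation ρ := ⟨p.map S.toSubmodule.subtype, by
      rintro g _ ⟨v, hv, rfl⟩
      exact ⟨_, hp g v hv, rfl⟩⟩
    have hP : P ≤ S := by
      rintro _ ⟨v, hv, rfl⟩
      exact v.2
    rcases hS.le_iff.1 hP with h | h
    · left
      have h1 : p.map S.toSubmodule.subtype = ⊥ := congrArg Subrepresentation.toSubmodule h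
      exact Submodule.map_injective_of_injective (Submodule.subtype_injective _)
        (h1.trans (Submodule.map_bot _).symm)
    · right
      have h1 : p.map S.toSubmodule.subtype = S.toSubmodule :=
        congrArg Subrepresentation.toSubmodule h
      rw [eq_top_iff]
      rintro v -
      have h2 : (v : V) ∈ p.map S.toSubmodule.subtype := by
        rw [h1]
        exact v.2
      obtain ⟨w, hw, hwv⟩ := h2
      rwa [← Subtype.ext (a1 := w) (a2 := v) hwv]

/-- Maschke's theorem: `|G|` is invertible, so invariant complements exist. -/
lemma exists_equiv_prod [Fintype G] [CharZero k] (ρ : Representation k G V) (S : Subrepresentation ρ) :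
    ∃ T : Subrepresentation ρ, Nonempty (Equiv (S.toRepresentation.prod T.toRepresentation) ρ) := by
  have : NeZero (Nat.card G : k) := ⟨by simp⟩
  obtain ⟨T, hT⟩ := exists_isCompl S
  have hT' : IsCompl S.toSubmodule T.toSubmodule := by
    refine ⟨?_, ?_⟩
    · rw [disjoint_iff]
      exact congrArg Subrepresentation.toSubmodule hT.inf_eq_bot
    · rw [codisjoint_iff]
      exact congrArg Subrepresentation.toSubmodule hT.sup_eq_top
  refine ⟨T, ⟨.mk (Submodule.prodEquivOfIsCompl _ _ hT') fun g => ?_⟩⟩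
  ext v <;> simp [Subrepresentation.toRepresentation]

end Generalities

/-! ### Multiplicities as pairings in characteristic zero. -/

section CharZero

variable {G : Type*} [Group G] [Fintype G] {k : Type*} [Field k] [CharZero k]
  {V W : Type*} [AddCommGroup V] [Module k V] [FiniteDimensional k V]
  [AddCommGroup W] [Module k W] [FiniteDimensional k W]

lemma pairing_character_eq_finrank (ρ : Representation k G V) (σ : Representation k G W) :
    pairing σ.character ρ.character = Module.finrank k (IntertwiningMap ρ σ) := by
  let : Invertible (Nat.card G : k) := invertibleOfNonzero (by simp)
  exact card_inv_mul_sum_char_mul_char_eq_finrank ρ σ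

lemma exists_irreducible_prod [Nontrivial V] (ρ : Representation k G V) :
    ∃ S T : Subrepresentation ρ, S.toRepresentation.IsIrreducible ∧
      Nonempty (Equiv (S.toRepresentation.prod T.toRepresentation) ρ) := by
  obtain ⟨S, hS⟩ := exists_irreducible_subrepresentation ρ
  obtain ⟨T, hT⟩ := exists_equiv_prod ρ S
  exact ⟨S, T, hS, hT⟩

lemma exists_intertwiningMap_ne_zero {ρ : Representation k G V} {σ : Representation k G W}
    (h : pairing σ.character ρ.character ≠ 0) : ∃ f : IntertwiningMap ρ σ, f ≠ 0 := by
  rw [pairing_character_eq_finrank, Nat.cast_ne_zero] at h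
  by_contra! hf
  have : Subsingleton (IntertwiningMap ρ σ) := ⟨fun a b => by rw [hf a, hf b]⟩
  exact h Module.finrank_zero_of_subsingleton

/-- A nonzero intertwining map out of an irreducible representation is injective, and its image
splits off. -/
lemma exists_prod_of_pairing_ne_zero {ρ : Representation k G V} {σ : Representation k G W}
    (hρ : ρ.IsIrreducible) (h : pairing σ.character ρ.character ≠ 0) :
    ∃ T : Subrepresentation σ, Nonempty (Equiv (ρ.prod T.toRepresentation) σ) := by
  obtain ⟨f, hf⟩ := exists_intertwiningMap_ne_zero h
  have hinj : Function.Injective f := (IsIrreducible.injective_or_eq_zero f).resolve_right hf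
  obtain ⟨T, ⟨e⟩⟩ := exists_equiv_prod σ f.range
  let e1 : V ≃ₗ[k] f.range.toSubmodule := LinearEquiv.ofInjective f.toLinearMap hinj
  have he1 : ∀ g v, e1 (ρ g v) = f.range.toRepresentation g (e1 v) := fun g v =>
    Subtype.ext (IntertwiningMap.isIntertwining _ _ f g v)
  let e2 : Equiv (ρ.prod T.toRepresentation) (f.range.toRepresentation.prod T.toRepresentation) :=
    .mk (e1.prodCongr (.refl k T.toSubmodule)) fun g => by
      ext v <;> simp [he1]
  exact ⟨T, ⟨e2.trans e⟩⟩

lemma exists_equiv_of_pairing_ne_zero {ρ : Representation k G V} {σ : Representation k G W}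
    (hρ : ρ.IsIrreducible) (hσ : σ.IsIrreducible)
    (h : pairing σ.character ρ.character ≠ 0) : Nonempty (Equiv ρ σ) := by
  obtain ⟨f, hf⟩ := exists_intertwiningMap_ne_zero h
  exact ⟨f.ofBijective ((IsIrreducible.bijective_or_eq_zero f).resolve_right hf)⟩

lemma pairing_self_ne_zero [Nontrivial V] (ρ : Representation k G V) :
    pairing ρ.character ρ.character ≠ 0 := by
  rw [pairing_character_eq_finrank, Nat.cast_ne_zero]
  intro h
  have : Module.Finite k (IntertwiningMap ρ ρ) :=
    Module.Finite.of_injective (IntertwiningMap.toLinearMapl ρ ρ)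
      (IntertwiningMap.toLinearMap_injective ρ ρ)
  have := Module.finrank_zero_iff.1 h
  obtain ⟨v, hv⟩ := exists_ne (0 : V)
  exact hv (congrArg (fun f : IntertwiningMap ρ ρ => f v)
    (Subsingleton.elim (IntertwiningMap.id ρ) 0))

/-- Each nonzero summand in a decomposition contributes at least `1` to the norm, so two of them
would give at least `2`. -/
lemma isIrreducible_of_pairing_self_eq_one (ρ : Representation k G V)
    (h : pairing ρ.character ρ.character = 1) : ρ.IsIrreducible := by
  have hV : Nontrivial V := by
    by_contra hV
    rw [not_nontrivial_iff_subsingleton] at hV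
    have h0 : ρ.character = 0 := by
      ext g
      simp [Representation.character, Subsingleton.elim (ρ g) 0]
    simp [h0, pairing] at h
  obtain ⟨S, T, hS, ⟨e⟩⟩ := exists_irreducible_prod ρ
  have hS' := ((isIrreducible_iff _).1 hS).1
  have hT : Subsingleton T.toSubmodule := by
    by_contra hT
    rw [not_subsingleton_iff_nontrivial] at hT
    have h1 := pairing_self_ne_zero S.toRepresentation
    have h2 := pairing_self_ne_zero T.toRepresentation
    rw [← char_iso e, character_prod, pairing_add_left, pairing_add_right, pairing_add_right] at h
    rw [pairing_character_eq_finrank] at h1 h2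
    simp only [pairing_character_eq_finrank] at h
    norm_cast at h h1 h2
    omega
  have : Unique T.toSubmodule := Unique.mk' _
  let e' : Equiv S.toRepresentation ρ :=
    (Representation.Equiv.mk (LinearEquiv.prodUnique (R := k) (M := S.toSubmodule) (M₂ := T.toSubmodule)).symm
      fun g => LinearMap.ext fun v => Prod.ext (by simp) (Subsingleton.elim _ _)).trans e
  exact isIrreducible_of_equiv e' hS

end CharZero

/-! ### Unitarization by averaging. -/

section Unitary

open Matrix
open scoped MatrixOrder ComplexOrder

variable {G : Type*} [Group G] [Fintype G] {𝕜 : Type*} [RCLike 𝕜]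

/-- A matrix representation of a finite group is conjugate to a unitary one. -/
lemma exists_unitary_conj {n : Type*} [Fintype n] [DecidableEq n] (R : G →* Matrix n n 𝕜) :
    ∃ (U : (Matrix n n 𝕜)ˣ) (Q : G →* Matrix n n 𝕜),
      (∀ g, Q g = U * R g * (U⁻¹ : (Matrix n n 𝕜)ˣ)) ∧ ∀ g, (Q g)ᴴ = Q g⁻¹ := by
  let M : Matrix n n 𝕜 := ∑ g, (R g)ᴴ * R g
  have hM : M.PosDef := by
    classical
    have h1 : M = (R 1)ᴴ * R 1 + ∑ g ∈ Finset.univ.erase 1, (R g)ᴴ * R g :=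
      (Finset.add_sum_erase _ _ (Finset.mem_univ _)).symm
    rw [h1, map_one, conjTranspose_one, one_mul]
    exact PosDef.one.add_posSemidef
      (posSemidef_sum _ fun g _ => posSemidef_conjTranspose_mul_self (R g))
  have hinv (h : G) : (R h)ᴴ * M * R h = M := by
    simp only [M, Finset.mul_sum, Finset.sum_mul]
    refine Fintype.sum_equiv (Equiv.mulRight h) _ _ fun g => ?_
    simp [map_mul, conjTranspose_mul, mul_assoc]
  -- Writing the averaged invariant form as `M = Nᴴ N`, conjugation by `N` turns it into the
  -- standard form.
  obtain ⟨N, hN⟩ := CStarAlgebra.nonneg_iff_eq_star_mul_self.mp hM.posSemidef.nonneg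
  rw [star_eq_conjTranspose] at hN
  have hNu : IsUnit N := by
    have h := hM.isUnit
    rw [hN, Matrix.isUnit_iff_isUnit_det, det_mul] at h
    rw [Matrix.isUnit_iff_isUnit_det]
    exact isUnit_of_mul_isUnit_right h
  obtain ⟨U, rfl⟩ := hNu
  let Q : G →* Matrix n n 𝕜 :=
    { toFun := fun g => U * R g * (U⁻¹ : (Matrix n n 𝕜)ˣ)
      map_one' := by simp
      map_mul' := fun g h => by
        rw [map_mul]
        simp only [mul_assoc, Units.inv_mul_cancel_left] }
  refine ⟨U, Q, fun g => rfl, fun g => ?_⟩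
  have hQ : (Q g)ᴴ * Q g = 1 := by
    have h := hinv g
    rw [hN] at h
    have h2 : (Q g)ᴴ * Q g = ((U⁻¹ : (Matrix n n 𝕜)ˣ) : Matrix n n 𝕜)ᴴ *
        ((R g)ᴴ * ((U : Matrix n n 𝕜)ᴴ * U) * R g) * (U⁻¹ : (Matrix n n 𝕜)ˣ) := by
      simp only [Q, MonoidHom.coe_mk, OneHom.coe_mk, conjTranspose_mul, mul_assoc]
    rw [h2, h]
    simp only [← mul_assoc, ← conjTranspose_mul]
    simp
  calc (Q g)ᴴ = (Q g)ᴴ * (Q g * Q g⁻¹) := by rw [← map_mul]; simp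
    _ = Q g⁻¹ := by rw [← mul_assoc, hQ, one_mul]

/-- A representation of a finite group over `ℝ` or `ℂ` is equivalent to one by unitary
matrices. -/
lemma exists_equiv_unitary {V : Type*} [AddCommGroup V] [Module 𝕜 V] [FiniteDimensional 𝕜 V]
    (ρ : Representation 𝕜 G V) :
    ∃ (n : ℕ) (Q : G →* Matrix (Fin n) (Fin n) 𝕜), Nonempty (Equiv ρ (ofMatrix Q)) ∧
      ∀ g, (Q g)ᴴ = Q g⁻¹ := by
  let b := Module.finBasis 𝕜 V
  obtain ⟨U, Q, hQ, hQ'⟩ := exists_unitary_conj (toMatrixHom b ρ)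
  refine ⟨_, Q, ⟨(equivOfMatrix b ρ).trans (.mk (LinearEquiv.ofLinearMap (toLin' U.val)
    (toLin' U⁻¹.val) ?_ ?_) fun g => ?_)⟩, hQ'⟩
  · rw [← toLin'_mul]; simp
  · rw [← toLin'_mul]; simp
  · refine LinearMap.ext fun v => ?_
    simp [hQ]

lemma character_inv {V : Type*} [AddCommGroup V] [Module 𝕜 V] [FiniteDimensional 𝕜 V]
    (ρ : Representation 𝕜 G V) (g : G) : ρ.character g⁻¹ = star (ρ.character g) := by
  obtain ⟨n, Q, ⟨e⟩, hQ⟩ := exists_equiv_unitary ρ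
  rw [char_iso e, ofMatrix_character, ofMatrix_character, ← hQ, trace_conjTranspose]

end Unitary

/-! ### Complex structures on real representations. -/

section ComplexStructure

variable {G : Type*} [Group G]

/-- A real representation has a complex structure if it has an equivariant endomorphism with
square `-1`. -/
def HasComplexStructure {V : Type*} [AddCommGroup V] [Module ℝ V] (ρ : Representation ℝ G V) :
    Prop :=
  ∃ J : V →ₗ[ℝ] V, (∀ g v, J (ρ g v) = ρ g (J v)) ∧ ∀ v, J (J v) = -v

variable {V W : Type*} [AddCommGroup V] [Module ℝ V] [AddCommGroup W] [Module ℝ W]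

lemma HasComplexStructure.of_equiv {ρ : Representation ℝ G V} {σ : Representation ℝ G W}
    (e : Equiv ρ σ) (h : HasComplexStructure ρ) : HasComplexStructure σ := by
  have he (g : G) (v : V) : e.toLinearEquiv (ρ g v) = σ g (e.toLinearEquiv v) :=
    IntertwiningMap.isIntertwining _ _ e.toIntertwiningMap g v
  generalize e.toLinearEquiv = e' at he
  obtain ⟨J, hJ, hJ2⟩ := h
  refine ⟨e'.toLinearMap ∘ₗ J ∘ₗ e'.symm.toLinearMap, fun g w => ?_, fun w => ?_⟩
  · obtain ⟨v, rfl⟩ := e'.surjective w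
    simp [← he, hJ]
  · simp [hJ2]

lemma HasComplexStructure.prod {ρ : Representation ℝ G V} {σ : Representation ℝ G W}
    (hρ : HasComplexStructure ρ) (hσ : HasComplexStructure σ) :
    HasComplexStructure (ρ.prod σ) := by
  obtain ⟨J, hJ, hJ2⟩ := hρ
  obtain ⟨K, hK, hK2⟩ := hσ
  exact ⟨J.prodMap K, fun g v => by simp [hJ, hK], fun v => by simp [hJ2, hK2]; rfl⟩

/-- Two copies of any `ρ` carry `(a, b) ↦ (-b, a)`; the structure on `σ` fills the remaining
summand. -/
lemma hasComplexStructure_prod_prod (ρ : Representation ℝ G V) {σ : Representation ℝ G W}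
    (hσ : HasComplexStructure σ) : HasComplexStructure (ρ.prod (ρ.prod σ)) := by
  obtain ⟨K, hK, hK2⟩ := hσ
  refine ⟨(-(LinearMap.fst ℝ V W ∘ₗ LinearMap.snd ℝ V (V × W))).prod
    ((LinearMap.fst ℝ V (V × W)).prod (K ∘ₗ LinearMap.snd ℝ V W ∘ₗ LinearMap.snd ℝ V (V × W))),
    fun g v => ?_, fun v => ?_⟩
  · simp [hK]
  · simp [hK2]
    rfl

end ComplexStructure

/-! ### Real Schur lemma and the Frobenius–Schur count. -/

section FrobeniusSchur

open Matrix

lemma mul_single_mul_apply {m k : Type*} [Fintype m] [DecidableEq m] [CommRing k]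
    (A B : Matrix m m k) (a b i j : m) :
    (A * single a b (1 : k) * B : Matrix m m k) i j = A i a * B b j := by
  simp [mul_apply, single_apply, ite_and]

variable {G : Type*} [Group G] {n : Type*} [Fintype n] [DecidableEq n]

/-- The eigenspace of `c` is invariant and nonzero, hence everything. The eigenvector is a
hypothesis because the field need not be algebraically closed. -/
lemma eq_smul_one_of_commute {k : Type*} [Field k] {R : G →* Matrix n n k}
    (hR : (ofMatrix R).IsIrreducible)
    {Y : Matrix n n k} (hY : ∀ g, Y * R g = R g * Y) {c : k} {v : n → k} (hv : v ≠ 0)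
    (hc : Y *ᵥ v = c • v) : Y = c • 1 := by
  rw [isIrreducible_iff] at hR
  rcases hR.2 (LinearMap.ker (toLin' (Y - c • 1))) (fun g w hw => by
    simp only [LinearMap.mem_ker, toLin'_apply, ofMatrix_apply, mulVec_mulVec] at hw ⊢
    rw [sub_mul, hY, smul_mul_assoc, one_mul, ← mul_one (c • R g), smul_mul_assoc,
      ← mul_smul_comm, ← mul_sub, ← mulVec_mulVec, hw, mulVec_zero]) with h | h
  · refine absurd ?_ hv
    rw [← Submodule.mem_bot k, ← h]
    simp [hc]
  · rw [LinearMap.ker_eq_top, LinearEquiv.map_eq_zero_iff, sub_eq_zero] at h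
    exact h

lemma exists_eq_smul_one_of_isSymm {R : G →* Matrix n n ℝ}
    (hR : (ofMatrix R).IsIrreducible) {Y : Matrix n n ℝ} (hY : ∀ g, Y * R g = R g * Y)
    (hs : Yᵀ = Y) : ∃ c : ℝ, Y = c • 1 := by
  have hH : Y.IsHermitian := by rw [IsHermitian, conjTranspose_eq_transpose_of_trivial, hs]
  have hn : Nonempty n := by
    by_contra hn
    rw [not_nonempty_iff] at hn
    have := ((isIrreducible_iff _).1 hR).1
    exact not_subsingleton (n → ℝ) inferInstance
  obtain ⟨i⟩ := hn
  refine ⟨hH.eigenvalues i, eq_smul_one_of_commute hR hY (v := hH.eigenvectorBasis i) ?_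
    (hH.mulVec_eigenvectorBasis i)⟩
  intro h
  apply hH.eigenvectorBasis.orthonormal.ne_zero i
  ext j
  exact congrFun h j

variable {R : G →* Matrix n n ℝ}

lemma transpose_commute (hRt : ∀ g, (R g)ᵀ = R g⁻¹) {Y : Matrix n n ℝ}
    (hY : ∀ g, Y * R g = R g * Y) (g : G) : Yᵀ * R g = R g * Yᵀ := by
  have h := congrArg transpose (hY g⁻¹)
  simpa only [transpose_mul, hRt, inv_inv] using h.symm

/-- Symmetric commuting matrices are scalar by the spectral theorem, so a non-scalar commuting `X`
has a nonzero skew part `Z`. Then `Zᵀ Z = -Z²` is a positive scalar `c`, and `Z / √c` squares to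
`-1`. -/
lemma exists_sq_eq_neg_one_or_eq_smul_one (hR : (ofMatrix R).IsIrreducible)
    (hRt : ∀ g, (R g)ᵀ = R g⁻¹) :
    (∃ J : Matrix n n ℝ, (∀ g, J * R g = R g * J) ∧ J * J = -1) ∨
      ∀ Y : Matrix n n ℝ, (∀ g, Y * R g = R g * Y) → ∃ c : ℝ, Y = c • 1 := by
  rw [or_iff_not_imp_right]
  intro h
  push Not at h
  obtain ⟨X, hX, hXc⟩ := h
  let Z := X - Xᵀ
  have hZ (g : G) : Z * R g = R g * Z := by
    rw [sub_mul, mul_sub, hX, transpose_commute hRt hX]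
  have hZt : Zᵀ = -Z := by simp [Z]
  have hZ0 : Z ≠ 0 := by
    intro h0
    obtain ⟨c, hc⟩ := exists_eq_smul_one_of_isSymm hR hX (sub_eq_zero.1 h0).symm
    exact hXc c hc
  obtain ⟨c, hc⟩ := exists_eq_smul_one_of_isSymm hR (Y := Zᵀ * Z)
    (fun g => by rw [mul_assoc, hZ, ← mul_assoc, transpose_commute hRt hZ, mul_assoc])
    (by simp)
  have hn : Nonempty n := by
    by_contra hn
    rw [not_nonempty_iff] at hn
    exact hZ0 (Subsingleton.elim _ _)
  have hcpos : 0 < c := by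
    obtain ⟨i⟩ := hn
    have h0 : ∀ i, c = ∑ j, Z j i * Z j i := fun i => by
      have := congrFun (congrFun hc i) i
      simpa [mul_apply] using this.symm
    refine lt_of_le_of_ne (h0 i ▸ Finset.sum_nonneg fun j _ => mul_self_nonneg _) fun hc0 => hZ0 ?_
    ext j k
    have := h0 k
    rw [← hc0, eq_comm, Finset.sum_eq_zero_iff_of_nonneg fun j _ => mul_self_nonneg _] at this
    exact mul_self_eq_zero.1 (this j (Finset.mem_univ j))
  refine ⟨(√c)⁻¹ • Z, fun g => by rw [smul_mul_assoc, hZ, mul_smul_comm], ?_⟩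
  rw [hZt, neg_mul, neg_eq_iff_eq_neg] at hc
  rw [smul_mul_smul_comm, hc, smul_neg, smul_smul, ← mul_inv, Real.mul_self_sqrt hcpos.le,
    inv_mul_cancel₀ hcpos.ne', one_smul]

variable [Fintype G]

/-- For a real irreducible orthogonal representation, the Frobenius-Schur indicator and the norm
of the character add up to `2`. -/
lemma sum_trace_sq_add_sum_trace_mul_trace (hR : (ofMatrix R).IsIrreducible)
    (hRt : ∀ g, (R g)ᵀ = R g⁻¹) :
    ∑ g, (R (g ^ 2)).trace + ∑ g, (R g).trace * (R g⁻¹).trace = 2 * Nat.card G := by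
  -- Averaging `X + Xᵀ` gives a symmetric commuting matrix, hence a scalar. Summing the `(i, j)`
  -- entries of `Φ (single i j 1)` yields both trace sums when expanded; by scalarity only `i = j`
  -- survives, leaving an entry of `Φ 1`, namely `2 |G|`.
  let Φ : Matrix n n ℝ →+ Matrix n n ℝ :=
    AddMonoidHom.mk' (fun X => ∑ g, R g * (X + Xᵀ) * R g⁻¹) fun X Y => by
      simp only [transpose_add, mul_add, add_mul, Finset.sum_add_distrib]
      abel
  have hΦX (X : Matrix n n ℝ) : Φ X = ∑ g, R g * (X + Xᵀ) * R g⁻¹ := rfl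
  have hΦ (X : Matrix n n ℝ) : ∃ c : ℝ, Φ X = c • 1 := by
    refine exists_eq_smul_one_of_isSymm hR (fun h => ?_) ?_
    · simp only [hΦX, Finset.sum_mul, Finset.mul_sum]
      refine Fintype.sum_equiv (Equiv.mulLeft h⁻¹) _ _ fun g => ?_
      simp only [Equiv.coe_mulLeft, _root_.mul_inv_rev, inv_inv, map_mul, ← mul_assoc]
      rw [← map_mul R h, mul_inv_cancel, map_one, one_mul]
    · simp only [hΦX, transpose_sum]
      refine Finset.sum_congr rfl fun g _ => ?_
      simp only [transpose_mul, hRt, inv_inv, transpose_add, transpose_transpose]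
      rw [add_comm Xᵀ, mul_assoc]
  have hn : Nonempty n := by
    by_contra hn
    rw [not_nonempty_iff] at hn
    have := ((isIrreducible_iff _).1 hR).1
    exact not_subsingleton (n → ℝ) inferInstance
  obtain ⟨k⟩ := hn
  have hentry (X : Matrix n n ℝ) (i j : n) : Φ X i j = if i = j then Φ X k k else 0 := by
    obtain ⟨c, hc⟩ := hΦ X
    simp [hc, one_apply]
  have hone : Φ 1 k k = 2 * Nat.card G := by
    have : Φ 1 = ∑ _g : G, (2 : ℝ) • (1 : Matrix n n ℝ) := by
      refine Finset.sum_congr rfl fun g _ => ?_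
      rw [transpose_one, ← two_smul ℝ (1 : Matrix n n ℝ), mul_smul_comm, mul_one, smul_mul_assoc,
        ← map_mul, mul_inv_cancel, map_one]
    rw [this]
    simp [mul_comm]
  have hsingle (i j : n) : Φ (single i j 1) i j =
      ∑ g, (R g i i * R g⁻¹ j j + R g i j * R g j i) := by
    rw [hΦX, Matrix.sum_apply]
    refine Finset.sum_congr rfl fun g _ => ?_
    have h2 : R g⁻¹ i j = R g j i := by rw [← hRt, transpose_apply]
    rw [mul_add, add_mul, Matrix.add_apply, transpose_single, mul_single_mul_apply,
      mul_single_mul_apply, h2]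
  have hsum : ∑ i, ∑ j, Φ (single i j 1) i j = 2 * Nat.card G := by
    have h1 : ∀ i, ∑ j, Φ (single i j 1) i j = Φ (single i i 1) k k := fun i => by
      simp_rw [hentry _ i]
      simp
    simp_rw [h1]
    rw [← Matrix.sum_apply, ← map_sum, sum_single_one, hone]
  rw [← hsum, add_comm]
  simp_rw [hsingle, Finset.sum_add_distrib]
  congr 1
  · simp_rw [trace, diag_apply, Finset.sum_mul_sum]
    rw [Finset.sum_comm]
    refine Finset.sum_congr rfl fun i _ => ?_
    rw [Finset.sum_comm]
  · simp_rw [pow_two, map_mul, trace, diag_apply, mul_apply]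
    rw [Finset.sum_comm]
    refine Finset.sum_congr rfl fun i _ => ?_
    rw [Finset.sum_comm]

variable {V : Type*} [AddCommGroup V] [Module ℝ V] [FiniteDimensional ℝ V]

/-- The Frobenius-Schur indicator and the norm of the character of a real irreducible
representation add up to `2`. -/
theorem sum_character_sq_add_pairing_self (ρ : Representation ℝ G V) (hρ : ρ.IsIrreducible) :
    (Nat.card G : ℝ)⁻¹ * ∑ g : G, ρ.character (g ^ 2) + pairing ρ.character ρ.character = 2 := by
  obtain ⟨n, R, ⟨e⟩, hR⟩ := exists_equiv_unitary ρ
  simp only [conjTranspose_eq_transpose_of_trivial] at hR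
  have h := sum_trace_sq_add_sum_trace_mul_trace (isIrreducible_of_equiv e hρ) hR
  have hG : (Nat.card G : ℝ) ≠ 0 := by simp
  simp only [pairing, char_iso e, ofMatrix_character]
  rw [← mul_add, h]
  field_simp

theorem hasComplexStructure_or_pairing_self_eq_one (ρ : Representation ℝ G V)
    (hρ : ρ.IsIrreducible) :
    HasComplexStructure ρ ∨ pairing ρ.character ρ.character = 1 := by
  obtain ⟨n, R, ⟨e⟩, hR⟩ := exists_equiv_unitary ρ
  simp only [conjTranspose_eq_transpose_of_trivial] at hR
  have hirr := isIrreducible_of_equiv e hρ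
  rcases exists_sq_eq_neg_one_or_eq_smul_one hirr hR with ⟨J, hJ, hJ2⟩ | h
  · left
    refine HasComplexStructure.of_equiv e.symm ⟨toLin' J, fun g v => ?_, fun v => ?_⟩
    · simp [hJ]
    · simp [hJ2, neg_mulVec]
  · right
    rw [char_iso e, pairing_character_eq_finrank]
    have := ((isIrreducible_iff _).1 hirr).1
    obtain ⟨v, hv⟩ := exists_ne (0 : Fin n → ℝ)
    norm_cast
    refine finrank_eq_one (IntertwiningMap.id _) (fun h0 => hv ?_) fun f => ?_
    · exact congrArg (fun f : IntertwiningMap (ofMatrix R) (ofMatrix R) => f v) h0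
    · obtain ⟨c, hc⟩ := h (LinearMap.toMatrix' f.toLinearMap) fun g => by
        have := f.isIntertwining' g
        have hg : ofMatrix R g = toLin' (R g) := rfl
        apply toLin'.injective
        rw [toLin'_mul, toLin'_mul, toLin'_toMatrix', ← hg, this]
      refine ⟨c, IntertwiningMap.ext ?_⟩
      rw [← toLin'_toMatrix' f.toLinearMap, hc]
      ext1
      simp

end FrobeniusSchur

/-! ### The even multiplicity criterion. -/

section EvenMultiplicities

variable {G : Type*} [Group G] {V W : Type*} [AddCommGroup V] [Module ℝ V] [AddCommGroup W]
  [Module ℝ W]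
variable [Fintype G] [FiniteDimensional ℝ V] [FiniteDimensional ℝ W]

/-- Composition with `J` is an operator `K` with `K² = -1` on the real space of intertwining maps `σ
→ ρ`. Since `(det K)² = (-1)^dim`, the dimension is even. -/
lemma HasComplexStructure.exists_pairing_eq_two_mul {ρ : Representation ℝ G V}
    (hρ : HasComplexStructure ρ) (σ : Representation ℝ G W) :
    ∃ k : ℕ, pairing ρ.character σ.character = 2 * k := by
  obtain ⟨J, hJ, hJ2⟩ := hρ
  let J' : IntertwiningMap ρ ρ := J.intertwiningMap_of_isIntertwiningMap ρ ρ hJ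
  let K : IntertwiningMap σ ρ →ₗ[ℝ] IntertwiningMap σ ρ := IntertwiningMap.llcomp σ ρ ρ J'
  have hK : K * K = (-1 : ℝ) • 1 := by
    ext f v
    have : (K * K) f v = J (J (f v)) := rfl
    simp only [IntertwiningMap.toLinearMap_apply]
    rw [this, hJ2]
    simp
  have : Module.Finite ℝ (IntertwiningMap σ ρ) :=
    Module.Finite.of_injective (IntertwiningMap.toLinearMapl σ ρ)
      (IntertwiningMap.toLinearMap_injective σ ρ)
  have hdet := congrArg LinearMap.det hK
  rw [map_mul, LinearMap.det_smul, map_one, mul_one] at hdet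
  rw [pairing_character_eq_finrank]
  rcases Nat.even_or_odd (Module.finrank ℝ (IntertwiningMap σ ρ)) with h | h
  · obtain ⟨k, hk⟩ := h
    exact ⟨k, by rw [hk]; push_cast; ring⟩
  · rw [h.neg_one_pow] at hdet
    nlinarith [mul_self_nonneg (LinearMap.det K)]

/-- The multiplicity of every absolutely irreducible real representation in `φ` is even. -/
def HasEvenRealMultiplicities (φ : G → ℝ) : Prop :=
  ∀ (n : ℕ) (σ : Representation ℝ G (Fin n → ℝ)), σ.IsIrreducible →
    pairing σ.character σ.character = 1 → ∃ k : ℕ, pairing φ σ.character = 2 * k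

end EvenMultiplicities

/-- Induction on dimension, splitting off an irreducible `S`. If `S` has a complex structure, it is
removed alone; otherwise parity forces a second copy, and both are removed together. -/
theorem hasComplexStructure_of_hasEvenRealMultiplicities {G : Type*} [Group G] [Fintype G] (n : ℕ) :
    ∀ {V : Type*} [AddCommGroup V] [Module ℝ V] [FiniteDimensional ℝ V]
      (ρ : Representation ℝ G V), Module.finrank ℝ V = n →
      HasEvenRealMultiplicities ρ.character → HasComplexStructure ρ := by
  induction n using Nat.strong_induction_on with
  | _ n ih =>
  intro V _ _ _ ρ hn h
  rcases subsingleton_or_nontrivial V with hV | hV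
  · exact ⟨0, fun g v => Subsingleton.elim _ _, fun v => Subsingleton.elim _ _⟩
  obtain ⟨S, T, hS, ⟨e⟩⟩ := exists_irreducible_prod ρ
  have hχ : ρ.character = S.toRepresentation.character + T.toRepresentation.character := by
    rw [← char_iso e, character_prod]
  have hfin : Module.finrank ℝ S.toSubmodule + Module.finrank ℝ T.toSubmodule = n := by
    rw [← hn, ← e.toLinearEquiv.finrank_eq, Module.finrank_prod]
  have hSpos : 0 < Module.finrank ℝ S.toSubmodule := by
    have := ((isIrreducible_iff _).1 hS).1
    exact Module.finrank_pos
  rcases hasComplexStructure_or_pairing_self_eq_one _ hS with hJ | h1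
  · refine (hJ.prod (ih (Module.finrank ℝ T.toSubmodule) (by omega) T.toRepresentation rfl
      fun m σ hσ hσ1 => ?_)).of_equiv e
    obtain ⟨k, hk⟩ := h m σ hσ hσ1
    -- An absolutely irreducible `σ` isomorphic to `S` would inherit its complex structure, making
    -- the norm `1` even.
    have h0 : pairing S.toRepresentation.character σ.character = 0 := by
      by_contra h0
      obtain ⟨f⟩ := exists_equiv_of_pairing_ne_zero hσ hS h0
      obtain ⟨j, hj⟩ := (hJ.of_equiv f.symm).exists_pairing_eq_two_mul σ
      rw [hσ1] at hj
      norm_cast at hj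
      omega
    rw [hχ, pairing_add_left, h0, zero_add] at hk
    exact ⟨k, hk⟩
  · obtain ⟨m, σ, ⟨f⟩⟩ := exists_equiv_fin S.toRepresentation
    have hσχ := char_iso f
    obtain ⟨k, hk⟩ := h m σ (isIrreducible_of_equiv f hS) (by rw [← hσχ, h1])
    have h2 : pairing T.toRepresentation.character S.toRepresentation.character ≠ 0 := by
      intro h0
      rw [hχ, ← hσχ, pairing_add_left, h1, h0] at hk
      norm_cast at hk
      omega
    obtain ⟨U, ⟨f'⟩⟩ := exists_prod_of_pairing_ne_zero hS h2
    have hfin' : Module.finrank ℝ S.toSubmodule + Module.finrank ℝ U.toSubmodule =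
        Module.finrank ℝ T.toSubmodule := by
      rw [← f'.toLinearEquiv.finrank_eq, Module.finrank_prod]
    have hTχ := char_iso f'
    rw [character_prod] at hTχ
    have hU := ih (Module.finrank ℝ U.toSubmodule) (by omega) U.toRepresentation rfl
      fun m σ hσ hσ1 => by
        obtain ⟨k, hk⟩ := h m σ hσ hσ1
        rw [hχ, ← hTχ, pairing_add_left, pairing_add_left] at hk
        simp only [pairing_character_eq_finrank] at hk ⊢
        norm_cast at hk
        refine ⟨k - Module.finrank ℝ (IntertwiningMap σ S.toRepresentation), ?_⟩
        norm_cast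
        omega
    let e2 : Equiv (S.toRepresentation.prod (S.toRepresentation.prod U.toRepresentation))
        (S.toRepresentation.prod T.toRepresentation) :=
      .mk (.prodCongr (.refl ℝ S.toSubmodule) f'.toLinearEquiv) fun g => by
        refine LinearMap.ext fun v => Prod.ext rfl ?_
        exact IntertwiningMap.isIntertwining _ _ f'.toIntertwiningMap g v.2
    exact (hasComplexStructure_prod_prod S.toRepresentation hU).of_equiv (e2.trans e)

/-! ### Restriction of scalars and real forms. -/

section RestrictScalars

variable {G : Type*} [Group G]

lemma character_mem_irr {V : Type*} [AddCommGroup V] [Module ℂ V] [FiniteDimensional ℂ V]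
    {ρ : Representation ℂ G V} (hρ : ρ.IsIrreducible) : ρ.character ∈ Irr G := by
  obtain ⟨n, σ, ⟨e⟩⟩ := exists_equiv_fin ρ
  exact ⟨n, σ, isIrreducible_of_equiv e hρ, char_iso e⟩

/-- Restriction of scalars of a representation. -/
def restrictScalars (k : Type*) {K : Type*} [Field k] [Field K] [Algebra k K] {V : Type*}
    [AddCommGroup V] [Module K V] [Module k V] [IsScalarTower k K V]
    (ρ : Representation K G V) : Representation k G V where
  toFun g := (ρ g).restrictScalars k
  map_one' := by ext; simp
  map_mul' g h := by ext; simp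

lemma trace_restrictScalars (k : Type*) {K : Type*} [Field k] [Field K] [Algebra k K]
    [FiniteDimensional k K] {V : Type*} [AddCommGroup V] [Module K V] [FiniteDimensional K V]
    [Module k V] [IsScalarTower k K V] (f : V →ₗ[K] V) :
    LinearMap.trace k V (f.restrictScalars k) = Algebra.trace k K (LinearMap.trace K V f) := by
  classical
  let b := Module.finBasis k K
  let c := Module.finBasis K V
  rw [LinearMap.trace_eq_matrix_trace k (b.smulTower c), LinearMap.trace_eq_matrix_trace K c,
    Matrix.trace, Matrix.trace, map_sum, Fintype.sum_prod_type_right]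
  refine Finset.sum_congr rfl fun j _ => ?_
  rw [Algebra.trace_eq_matrix_trace b, Matrix.trace]
  refine Finset.sum_congr rfl fun i _ => ?_
  simp [Matrix.diag_apply, LinearMap.toMatrix_apply, Algebra.leftMulMatrix_eq_repr_mul,
    Module.Basis.smulTower_repr, Module.Basis.smulTower_apply, mul_comm]

lemma character_restrictScalars (k : Type*) {K : Type*} [Field k] [Field K] [Algebra k K]
    [FiniteDimensional k K] {V : Type*} [AddCommGroup V] [Module K V] [FiniteDimensional K V]
    [Module k V] [IsScalarTower k K V] (ρ : Representation K G V) (g : G) :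
    (restrictScalars k ρ).character g = Algebra.trace k K (ρ.character g) :=
  trace_restrictScalars k (ρ g)

/-- A complex irreducible representation with a proper nonzero real invariant subspace has a
real form. -/
lemma exists_real_form {V : Type*} [AddCommGroup V] [Module ℂ V] [FiniteDimensional ℂ V]
    (ρ : Representation ℂ G V) (hρ : ρ.IsIrreducible) (p : Submodule ℝ V)
    (hp : ∀ g, ∀ v ∈ p, ρ g v ∈ p) (hbot : p ≠ ⊥) (htop : p ≠ ⊤) :
    ∃ σ : Representation ℝ G p, ∀ g, (σ.character g : ℂ) = ρ.character g := by
  have : FiniteDimensional ℝ V := FiniteDimensional.complexToReal V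
  have hρ' := ((isIrreducible_iff _).1 hρ).2
  let σ : Representation ℝ G p :=
    (⟨p, fun g v hv => hp g v hv⟩ : Subrepresentation (restrictScalars ℝ ρ)).toRepresentation
  let b := Module.finBasis ℝ p
  let v : Fin (Module.finrank ℝ p) → V := fun i => b i
  -- `p ∩ i p` is a complex invariant subspace contained in `p ≠ ⊤`, hence zero. Together with `p +
  -- i p = V` this makes a real basis of `p` a complex basis of `V`, with the same matrices.
  have hq (x : V) (hx : x ∈ p) (hIx : Complex.I • x ∈ p) : x = 0 := by
    let q : Submodule ℂ V :=
      { carrier := {x | x ∈ p ∧ Complex.I • x ∈ p}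
        add_mem' := fun ha hb => ⟨p.add_mem ha.1 hb.1, by
          rw [smul_add]; exact p.add_mem ha.2 hb.2⟩
        zero_mem' := ⟨p.zero_mem, by rw [smul_zero]; exact p.zero_mem⟩
        smul_mem' := fun c x hx => by
          have hc (y : V) : c • y = c.re • y + c.im • Complex.I • y := by
            conv_lhs => rw [← Complex.re_add_im c]
            rw [add_smul, mul_smul]
            rfl
          refine ⟨?_, ?_⟩
          · rw [hc]
            exact p.add_mem (p.smul_mem _ hx.1) (p.smul_mem _ hx.2)
          · rw [smul_comm, hc, smul_smul Complex.I, Complex.I_mul_I, neg_one_smul]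
            exact p.add_mem (p.smul_mem _ hx.2) (p.smul_mem _ (p.neg_mem hx.1)) }
    rcases hρ' q (fun g x hx => ⟨hp g x hx.1, by rw [← map_smul]; exact hp g _ hx.2⟩) with h | h
    · have : x ∈ q := ⟨hx, hIx⟩
      rwa [h, Submodule.mem_bot] at this
    · refine absurd (eq_top_iff.2 fun y _ => ?_) htop
      have : y ∈ q := h ▸ Submodule.mem_top
      exact this.1
  have hsumv (c : Fin (Module.finrank ℝ p) → ℝ) :
      ((∑ i, c i • b i : p) : V) = ∑ i, (c i : ℂ) • v i := by
    simp [v]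
  have hli : LinearIndependent ℂ v := by
    rw [Fintype.linearIndependent_iff]
    intro c hc
    let x : p := ∑ i, (c i).re • b i
    let y : p := ∑ i, (c i).im • b i
    have hxy : (x : V) + Complex.I • (y : V) = 0 := by
      rw [hsumv, hsumv, Finset.smul_sum, ← Finset.sum_add_distrib, ← hc]
      refine Finset.sum_congr rfl fun i _ => ?_
      rw [smul_smul, ← add_smul, mul_comm, Complex.re_add_im]
    have hy : (y : V) = 0 := hq y y.2 (by
      rw [← neg_eq_of_add_eq_zero_right hxy]
      exact p.neg_mem x.2)
    rw [hy, smul_zero, add_zero] at hxy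
    have h1 := Fintype.linearIndependent_iff.1 b.linearIndependent _ (Subtype.ext hxy)
    have h2 := Fintype.linearIndependent_iff.1 b.linearIndependent _ (Subtype.ext hy)
    exact fun i => Complex.ext (h1 i) (h2 i)
  have hpspan (x : V) (hx : x ∈ p) : x ∈ Submodule.span ℂ (Set.range v) := by
    have := hsumv (b.repr ⟨x, hx⟩)
    rw [b.sum_repr] at this
    change x = _ at this
    rw [this]
    exact Submodule.sum_mem _ fun i _ => Submodule.smul_mem _ _ (Submodule.subset_span ⟨i, rfl⟩)
  have hspan : ⊤ ≤ Submodule.span ℂ (Set.range v) := by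
    rcases hρ' (Submodule.span ℂ (Set.range v)) (fun g x hx => by
      induction hx using Submodule.span_induction with
      | mem x hx =>
        obtain ⟨i, rfl⟩ := hx
        exact hpspan _ (hp g _ (b i).2)
      | zero => rw [map_zero]; exact Submodule.zero_mem _
      | add x y _ _ hx hy => rw [map_add]; exact Submodule.add_mem _ hx hy
      | smul c x _ hx => rw [map_smul]; exact Submodule.smul_mem _ _ hx) with h | h
    · refine absurd (eq_bot_iff.2 fun x hx => ?_) hbot
      have := hpspan x hx
      rwa [h, Submodule.mem_bot] at this
    · exact h.ge
  let B := Module.Basis.mk hli hspan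
  refine ⟨σ, fun g => ?_⟩
  rw [Representation.character, Representation.character, LinearMap.trace_eq_matrix_trace ℝ b,
    LinearMap.trace_eq_matrix_trace ℂ B, Matrix.trace, Matrix.trace]
  push_cast
  refine Finset.sum_congr rfl fun j _ => ?_
  have hj : ρ g (B j) = ∑ i, ((b.repr (σ g (b j)) i : ℝ) : ℂ) • B i := by
    have h1 := hsumv (b.repr (σ g (b j)))
    rw [b.sum_repr] at h1
    simp only [B, Module.Basis.mk_apply]
    exact h1
  rw [Matrix.diag_apply, Matrix.diag_apply, LinearMap.toMatrix_apply, LinearMap.toMatrix_apply, hj,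
    B.repr_sum_self]

end RestrictScalars

/-! ### Complex irreducible characters and their indicators. -/

section ComplexIrreducible

variable {G : Type*} [Group G] [Fintype G]

lemma pairing_self_of_mem_irr {χ : G → ℂ} (hχ : χ ∈ Irr G) : pairing χ χ = 1 := by
  obtain ⟨n, σ, hσ, rfl⟩ := hχ
  rw [pairing_character_eq_finrank, IsIrreducible.finrank_intertwiningMap_self, Nat.cast_one]

lemma pairing_eq_zero_of_mem_irr {χ ψ : G → ℂ} (hχ : χ ∈ Irr G) (hψ : ψ ∈ Irr G) (h : χ ≠ ψ) :
    pairing χ ψ = 0 := by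
  obtain ⟨n, σ, hσ, rfl⟩ := hχ
  obtain ⟨m, τ, hτ, rfl⟩ := hψ
  by_contra h0
  obtain ⟨e⟩ := exists_equiv_of_pairing_ne_zero hτ hσ h0
  exact h (char_iso e).symm

/-- Irreducibility is norm `1`. The pairing uses `g⁻¹` rather than complex conjugation, so it is
respected by every `τ`, even one not commuting with conjugation. -/
lemma comp_mem_irr (τ : ℂ →+* ℂ) {χ : G → ℂ} (hχ : χ ∈ Irr G) : τ ∘ χ ∈ Irr G := by
  have h1 := pairing_self_of_mem_irr hχ
  obtain ⟨n, σ, hσ, rfl⟩ := hχ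
  obtain ⟨m, σ', hσ'⟩ := exists_character_eq_comp τ σ
  rw [← hσ']
  refine character_mem_irr (isIrreducible_of_pairing_self_eq_one σ' ?_)
  rw [hσ', ← map_pairing, h1, map_one]

lemma apply_inv_of_mem_irr {χ : G → ℂ} (hχ : χ ∈ Irr G) (g : G) :
    χ g⁻¹ = starRingEnd ℂ (χ g) := by
  obtain ⟨n, σ, hσ, rfl⟩ := hχ
  exact character_inv σ g

lemma charInner_eq_pairing (φ : G → ℂ) {χ : G → ℂ} (hχ : χ ∈ Irr G) :
    charInner φ χ = pairing φ χ := by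
  simp only [charInner, pairing, apply_inv_of_mem_irr hχ, Nat.card_eq_fintype_card]

/-- Every character is a sum of irreducible characters. -/
lemma exists_character_eq_sum_irr {V : Type*} [AddCommGroup V] [Module ℂ V]
    [FiniteDimensional ℂ V] (ρ : Representation ℂ G V) :
    ∃ (m : ℕ) (ψ : Fin m → G → ℂ), (∀ i, ψ i ∈ Irr G) ∧ ρ.character = ∑ i, ψ i := by
  induction hn : Module.finrank ℂ V using Nat.strong_induction_on generalizing V with
  | _ n ih =>
  rcases subsingleton_or_nontrivial V with hV | hV
  · refine ⟨0, fun _ => 0, fun i => i.elim0, ?_⟩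
    ext g
    simp [Representation.character, Subsingleton.elim (ρ g) 0]
  obtain ⟨S, T, hS, ⟨e⟩⟩ := exists_irreducible_prod ρ
  have hfin : Module.finrank ℂ S.toSubmodule + Module.finrank ℂ T.toSubmodule = n := by
    rw [← hn, ← e.toLinearEquiv.finrank_eq, Module.finrank_prod]
  have hSpos : 0 < Module.finrank ℂ S.toSubmodule := by
    have := ((isIrreducible_iff _).1 hS).1
    exact Module.finrank_pos
  obtain ⟨m, ψ, hψ, hsum⟩ := ih (Module.finrank ℂ T.toSubmodule) (by omega) T.toRepresentation rfl
  refine ⟨m + 1, Fin.cons S.toRepresentation.character ψ, fun i => ?_, ?_⟩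
  · refine Fin.cases ?_ (fun j => ?_) i
    · exact character_mem_irr hS
    · exact hψ j
  · rw [← char_iso e, character_prod, hsum, Fin.sum_univ_succ]
    rfl

lemma frobeniusSchur_comp (τ : ℂ →+* ℂ) (χ : G → ℂ) :
    frobeniusSchur (τ ∘ χ) = τ (frobeniusSchur χ) := by
  simp [frobeniusSchur]

lemma conj_frobeniusSchur {χ : G → ℂ} (hχ : χ ∈ Irr G) :
    starRingEnd ℂ (frobeniusSchur χ) = frobeniusSchur χ := by
  simp only [frobeniusSchur, map_mul, map_inv₀, map_natCast, map_sum]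
  congr 1
  refine Fintype.sum_equiv (Equiv.inv G) _ _ fun g => ?_
  rw [← apply_inv_of_mem_irr hχ, Equiv.inv_apply, inv_pow]

lemma frobeniusSchur_of_real {V : Type*} [AddCommGroup V] [Module ℝ V] [FiniteDimensional ℝ V]
    (ρ : Representation ℝ G V) (hρ : ρ.IsIrreducible) :
    frobeniusSchur (fun g => (ρ.character g : ℂ)) =
      2 - pairing (fun g => (ρ.character g : ℂ)) (fun g => (ρ.character g : ℂ)) := by
  have h := congrArg Complex.ofRealHom (sum_character_sq_add_pairing_self ρ hρ)
  rw [map_add, map_pairing] at h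
  rw [eq_sub_iff_add_eq]
  simpa [frobeniusSchur, Nat.card_eq_fintype_card, Function.comp_def] using h

lemma exists_pairing_eq_natCast {k : Type*} [Field k] [CharZero k] (f : k →+* ℂ) {V : Type*}
    [AddCommGroup V] [Module k V] [FiniteDimensional k V] (ρ : Representation k G V)
    {χ : G → ℂ} (hχ : χ ∈ Irr G) : ∃ m : ℕ, pairing (f ∘ ρ.character) χ = m := by
  obtain ⟨n, σ, hσ, rfl⟩ := hχ
  obtain ⟨m, ρ', hρ'⟩ := exists_character_eq_comp f ρ
  rw [← hρ']
  exact ⟨_, pairing_character_eq_finrank σ ρ'⟩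

/-- If the restriction to `ℝ` is reducible, a real form exists. If it is irreducible, its character
`χ + χ̄` has norm `4` or `2` according to whether `χ` is real, and the rule that indicator and norm
add to `2` gives `2 ν₂(χ) = -2` or `0`. -/
theorem real_or_frobeniusSchur {χ : G → ℂ} (hχ : χ ∈ Irr G) :
    (∃ (n : ℕ) (σ : Representation ℝ G (Fin n → ℝ)), σ.IsIrreducible ∧
      pairing σ.character σ.character = 1 ∧ ∀ g, (σ.character g : ℂ) = χ g) ∨
    frobeniusSchur χ = 0 ∨ frobeniusSchur χ = -1 := by
  obtain ⟨n, ρ, hρ, hχρ⟩ := id hχ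
  have hnt := ((isIrreducible_iff _).1 hρ).1
  by_cases hR : (restrictScalars ℝ ρ).IsIrreducible
  · right
    have hχR : (fun g => ((restrictScalars ℝ ρ).character g : ℂ)) = χ + starRingEnd ℂ ∘ χ := by
      ext g
      rw [character_restrictScalars, Algebra.trace_complex_apply, ← hχρ, Pi.add_apply,
        Function.comp_apply, Complex.add_conj]
    have h := frobeniusSchur_of_real _ hR
    have hconj := comp_mem_irr (starRingEnd ℂ) hχ
    have hadd : frobeniusSchur (χ + starRingEnd ℂ ∘ χ) = 2 * frobeniusSchur χ := by
      have : frobeniusSchur (χ + starRingEnd ℂ ∘ χ) =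
          frobeniusSchur χ + frobeniusSchur (starRingEnd ℂ ∘ χ) := by
        simp [frobeniusSchur, Finset.sum_add_distrib, mul_add]
      rw [this, frobeniusSchur_comp, conj_frobeniusSchur hχ, two_mul]
    rw [hχR, hadd, pairing_add_left, pairing_add_right, pairing_add_right,
      pairing_comm (starRingEnd ℂ ∘ χ) χ, pairing_self_of_mem_irr hχ,
      pairing_self_of_mem_irr hconj] at h
    by_cases heq : χ = starRingEnd ℂ ∘ χ
    · right
      rw [← heq, pairing_self_of_mem_irr hχ] at h
      linear_combination h / 2
    · left
      rw [pairing_eq_zero_of_mem_irr hχ hconj heq] at h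
      linear_combination h / 2
  · left
    rw [isIrreducible_iff] at hR
    push Not at hR
    obtain ⟨p, hp, hbot, htop⟩ := hR hnt
    obtain ⟨σ, hσ⟩ := exists_real_form ρ hρ p hp hbot htop
    obtain ⟨m, σ', ⟨e⟩⟩ := exists_equiv_fin σ
    have hσ' : Complex.ofRealHom ∘ σ'.character = χ := by
      ext g
      rw [hχρ, ← hσ, char_iso e]
      rfl
    have h1 : pairing σ'.character σ'.character = 1 := by
      apply Complex.ofRealHom.injective
      rw [map_pairing, hσ', pairing_self_of_mem_irr hχ, map_one]
    exact ⟨m, σ', isIrreducible_of_pairing_self_eq_one σ' h1, h1, fun g => congrFun hσ' g⟩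

end ComplexIrreducible

/-! ### Extending embeddings of number fields to `ℂ`. -/

section ExtendEmbedding

open Cardinal

/-- An embedding of a countable field `F` into an algebraically closed field extends to every
uncountable algebraically closed extension of `F` of the same cardinality. -/
lemma exists_algHom_of_countable {F K M : Type} [Field F] [Field K] [Field M] [Algebra F K]
    [Algebra F M] [IsAlgClosed K] [IsAlgClosed M] (hF : #F ≤ ℵ₀) (hK : ℵ₀ < #K) (hKM : #K = #M) :
    Nonempty (K →ₐ[F] M) := by
  -- Over a countable field, a transcendence basis of an uncountable algebraically closed field has
  -- the cardinality of that field. A bijection of bases embeds the subalgebra generated by `s`, and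
  -- `K` is algebraic over it.
  obtain ⟨s, hs⟩ := exists_isTranscendenceBasis F K
  obtain ⟨t, ht⟩ := exists_isTranscendenceBasis F M
  have hst : #s = #t := by
    rw [← IsAlgClosed.cardinal_eq_cardinal_transcendence_basis_of_aleph0_lt' _ hs hF hK,
      ← IsAlgClosed.cardinal_eq_cardinal_transcendence_basis_of_aleph0_lt' _ ht hF (hKM ▸ hK), hKM]
  obtain ⟨e⟩ := Cardinal.eq.1 hst
  have hinj : Function.Injective (MvPolynomial.aeval (R := F) (fun i : s => (e i : M))) :=
    ht.1.comp e e.injective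
  let A := Algebra.adjoin F (Set.range ((↑) : s → K))
  let ψ : A →ₐ[F] M :=
    (MvPolynomial.aeval (R := F) (fun i : s => (e i : M))).comp hs.1.aevalEquiv.symm.toAlgHom
  have hψ : Function.Injective ψ := hinj.comp hs.1.aevalEquiv.symm.injective
  let _ : Algebra A M := ψ.toRingHom.toAlgebra
  have : FaithfulSMul A M := (faithfulSMul_iff_algebraMap_injective A M).2 hψ
  have : Algebra.IsAlgebraic A K := hs.isAlgebraic
  let f : K →ₐ[A] M := IsAlgClosed.lift
  refine ⟨{ f.toRingHom with commutes' := fun a => ?_ }⟩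
  have h1 : algebraMap F K a = algebraMap A K (algebraMap F A a) := rfl
  change f (algebraMap F K a) = _
  rw [h1, f.commutes]
  exact ψ.commutes a

/-- This turns an embedding of `ℚ(χ)` into a ring endomorphism of `ℂ`, which can be applied to
complex representations. -/
lemma exists_ringHom_extending (F : IntermediateField ℚ ℂ) [FiniteDimensional ℚ F]
    (σ : F →ₐ[ℚ] ℂ) : ∃ τ : ℂ →+* ℂ, ∀ x : F, τ x = σ x := by
  have hF : #F ≤ ℵ₀ := by
    have := Algebra.IsAlgebraic.cardinalMk_le_max ℚ F
    simpa using this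
  have hC : ℵ₀ < #ℂ := by
    rw [Cardinal.mk_complex]
    exact Cardinal.aleph0_lt_continuum
  obtain ⟨τ⟩ := @exists_algHom_of_countable F ℂ ℂ _ _ _ inferInstance σ.toRingHom.toAlgebra _ _
    hF hC rfl
  exact ⟨@AlgHom.toRingHom F ℂ ℂ _ _ _ _ σ.toRingHom.toAlgebra τ,
    @AlgHom.commutes F ℂ ℂ _ _ _ _ σ.toRingHom.toAlgebra τ⟩

end ExtendEmbedding

/-! ### Convolution identities and isotypic components. -/

section Isotypic

variable {G : Type*} [Group G]

lemma irr_apply_one_ne_zero {χ : G → ℂ} (hχ : χ ∈ Irr G) : χ 1 ≠ 0 := by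
  obtain ⟨n, σ, hσ, rfl⟩ := hχ
  have := ((isIrreducible_iff _).1 hσ).1
  rw [char_one, Nat.cast_ne_zero]
  exact Module.finrank_pos.ne'

lemma irr_conj {χ : G → ℂ} (hχ : χ ∈ Irr G) (g h : G) : χ (h * g * h⁻¹) = χ g := by
  obtain ⟨n, σ, hσ, rfl⟩ := hχ
  exact char_conj σ g h

variable [Fintype G]

lemma isIntegral_character {V : Type*} [AddCommGroup V] [Module ℂ V] [FiniteDimensional ℂ V]
    (ρ : Representation ℂ G V) (g : G) : IsIntegral ℚ (ρ.character g) := by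
  rw [Representation.character,
    Module.End.trace_eq_sum_roots_charpoly_of_splits (IsAlgClosed.splits _)]
  refine IsIntegral.multiset_sum fun μ hμ => ?_
  rw [Polynomial.mem_roots (LinearMap.charpoly_monic _).ne_zero,
    ← Module.End.hasEigenvalue_iff_isRoot_charpoly] at hμ
  obtain ⟨v, hv⟩ := hμ.exists_hasEigenvector
  have h := hv.pow_apply (Fintype.card G)
  rw [← map_pow, pow_card_eq_one, map_one, Module.End.one_apply] at h
  have h1 : μ ^ Fintype.card G = 1 := by
    have h2 : (μ ^ Fintype.card G - 1) • v = 0 := by rw [sub_smul, one_smul, ← h, sub_self]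
    exact sub_eq_zero.1 ((smul_eq_zero.1 h2).resolve_right hv.2)
  exact IsIntegral.of_pow Fintype.card_pos (h1 ▸ isIntegral_one)

lemma finiteDimensional_characterField {χ : G → ℂ} (hχ : χ ∈ Irr G) :
    FiniteDimensional ℚ (characterField χ) := by
  obtain ⟨n, σ, -, rfl⟩ := hχ
  refine IntermediateField.finiteDimensional_adjoin ?_
  rintro _ ⟨g, rfl⟩
  exact isIntegral_character σ g

/-- The operator `∑ χ(h⁻¹) σ(h)` commutes with `G`, so Schur's lemma makes it a scalar, determined
by its trace. -/
lemma irr_convolution {χ ψ : G → ℂ} (hχ : χ ∈ Irr G) (hψ : ψ ∈ Irr G) (g : G) :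
    χ 1 * ∑ h, χ h⁻¹ * ψ (g * h) = Nat.card G * pairing ψ χ * χ g := by
  obtain ⟨n, σ, hσ, hψσ⟩ := id hψ
  let Q : (Fin n → ℂ) →ₗ[ℂ] (Fin n → ℂ) := ∑ h, χ h⁻¹ • σ h
  have hQ (x : G) : Q ∘ₗ σ x = σ x ∘ₗ Q := by
    simp only [Q, ← Module.End.mul_eq_comp, Finset.sum_mul, Finset.mul_sum, smul_mul_assoc,
      mul_smul_comm, ← map_mul]
    refine Fintype.sum_equiv ((Equiv.mulLeft x⁻¹).trans (Equiv.mulRight x)) _ _ fun h => ?_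
    have h1 : x * (x⁻¹ * h * x) = h * x := by group
    have h2 : (x⁻¹ * h * x)⁻¹ = x⁻¹ * h⁻¹ * x⁻¹⁻¹ := by group
    simp only [Equiv.trans_apply, Equiv.coe_mulLeft, Equiv.coe_mulRight, h1, h2, irr_conj hχ]
  obtain ⟨c, hc⟩ := IsIrreducible.algebraMap_intertwiningMap_bijective_of_isAlgClosed.2
    (⟨Q, hQ⟩ : IntertwiningMap σ σ)
  have hQc : Q = c • LinearMap.id := (congrArg IntertwiningMap.toLinearMap hc).symm
  have htr (x : G) : ∑ h, χ h⁻¹ * ψ (x * h) = c * ψ x := by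
    have h1 : LinearMap.trace ℂ _ (σ x * Q) = ∑ h, χ h⁻¹ * ψ (x * h) := by
      simp only [Q, Finset.mul_sum, mul_smul_comm, ← map_mul, map_sum, map_smul, hψσ]
      rfl
    rw [← h1, hQc, Module.End.mul_eq_comp, LinearMap.comp_smul, LinearMap.comp_id, map_smul, hψσ]
    rfl
  have hN : (Nat.card G : ℂ) ≠ 0 := by simp
  have hpair : c * ψ 1 = Nat.card G * pairing ψ χ := by
    rw [← htr, pairing, mul_inv_cancel_left₀ hN]
    exact Finset.sum_congr rfl fun h _ => by rw [one_mul, mul_comm]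
  rw [htr]
  by_cases h : ψ = χ
  · subst h
    linear_combination (ψ g) * hpair
  · rw [pairing_eq_zero_of_mem_irr hψ hχ h, mul_zero] at hpair ⊢
    rw [(mul_eq_zero.1 hpair).resolve_right (irr_apply_one_ne_zero hψ)]
    ring

variable {k : Type*} [Field k] [CharZero k] {V : Type*} [AddCommGroup V] [Module k V]
  [FiniteDimensional k V]

lemma character_convolution (ι : k →+* ℂ) {f : G → k} (hf : ι ∘ f ∈ Irr G)
    (ρ : Representation k G V) (g : G) :
    f 1 * ∑ h, f h⁻¹ * ρ.character (g * h) = Nat.card G * pairing ρ.character f * f g := by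
  apply ι.injective
  obtain ⟨n, σ, hσ⟩ := exists_character_eq_comp ι ρ
  obtain ⟨m, ψ, hψ, hsum⟩ := exists_character_eq_sum_irr σ
  have hρ (x : G) : ι (ρ.character x) = ∑ i, ψ i x := by
    rw [← Finset.sum_apply, ← hsum, hσ]
    rfl
  simp only [map_mul, map_sum, map_natCast, map_pairing, ← hσ, hsum, hρ, pairing_sum_left]
  simp only [Finset.mul_sum, Finset.sum_mul]
  rw [Finset.sum_comm]
  refine Finset.sum_congr rfl fun i _ => ?_
  have h := irr_convolution hf (hψ i) g
  rw [Finset.mul_sum] at h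
  exact h

/-- The isotypic component of a representation that belongs to an irreducible character with
values in the ground field. -/
lemma exists_isotypic (ι : k →+* ℂ) {f : G → k} (hf : ι ∘ f ∈ Irr G)
    (ρ : Representation k G V) :
    ∃ (n : ℕ) (σ : Representation k G (Fin n → k)),
      ∀ g, σ.character g = pairing ρ.character f * f g := by
  have hN : (Nat.card G : k) ≠ 0 := by simp
  have hf1 : f 1 ≠ 0 := fun h0 => irr_apply_one_ne_zero hf (by simp [h0])
  have hfconj (g h : G) : f (h * g * h⁻¹) = f g := ι.injective (irr_conj hf g h)
  have hconv (g : G) : f 1 * ∑ h, f h⁻¹ * f (g * h) = Nat.card G * f g := by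
    apply ι.injective
    have h := irr_convolution hf hf g
    rw [pairing_self_of_mem_irr hf, mul_one] at h
    simpa using h
  -- `P` is the action of the central idempotent `f(1)/|G| ∑ f(h⁻¹) h`, defined over `k` because `f`
  -- is `k`-valued.
  let c : k := f 1 * (Nat.card G : k)⁻¹
  let P : V →ₗ[k] V := c • ∑ h, f h⁻¹ • ρ h
  have hPP : P * P = P := by
    have h1 : (∑ h, f h⁻¹ • ρ h) * (∑ h, f h⁻¹ • ρ h) =
        ∑ x, (∑ h, f h⁻¹ * f (x⁻¹ * h)) • ρ x := by
      simp only [Finset.sum_mul_sum, Finset.sum_smul]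
      conv_rhs => rw [Finset.sum_comm]
      refine Finset.sum_congr rfl fun h _ => ?_
      refine Fintype.sum_equiv (Equiv.mulLeft h) _ _ fun l => ?_
      rw [smul_mul_smul_comm, ← map_mul, Equiv.coe_mulLeft, _root_.mul_inv_rev, inv_mul_cancel_right]
    have h2 (x : G) : c * ∑ h, f h⁻¹ * f (x⁻¹ * h) = f x⁻¹ := by
      have := hconv x⁻¹
      simp only [c]
      field_simp
      linear_combination this
    simp only [P]
    rw [smul_mul_smul_comm, h1, mul_smul, Finset.smul_sum (r := c)]
    congr 1
    refine Finset.sum_congr rfl fun x _ => ?_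
    rw [smul_smul, h2]
  have hP (x : G) : P * ρ x = ρ x * P := by
    simp only [P, smul_mul_assoc, mul_smul_comm, Finset.sum_mul, Finset.mul_sum, ← map_mul]
    congr 1
    refine Fintype.sum_equiv ((Equiv.mulLeft x⁻¹).trans (Equiv.mulRight x)) _ _ fun h => ?_
    have h1 : x * (x⁻¹ * h * x) = h * x := by group
    have h2 : (x⁻¹ * h * x)⁻¹ = x⁻¹ * h⁻¹ * x⁻¹⁻¹ := by group
    simp only [Equiv.trans_apply, Equiv.coe_mulLeft, Equiv.coe_mulRight, h1, h2, hfconj]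
  let S : Subrepresentation ρ := ⟨LinearMap.range P, by
    rintro g _ ⟨v, rfl⟩
    exact ⟨ρ g v, congrArg (fun L : V →ₗ[k] V => L v) (hP g)⟩⟩
  have hS (g : G) : S.toRepresentation.character g = LinearMap.trace k V (ρ g * P) := by
    have hmem (x : V) : (ρ g * P) x ∈ S.toSubmodule :=
      S.apply_mem_toSubmodule g (LinearMap.mem_range_self P x)
    rw [← LinearMap.trace_restrict_eq_of_forall_mem S.toSubmodule (ρ g * P) hmem,
      Representation.character]
    congr 1
    refine LinearMap.ext ?_
    rintro ⟨_, v, rfl⟩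
    refine Subtype.ext ?_
    have : P (P v) = P v := congrArg (fun L : V →ₗ[k] V => L v) hPP
    simp [Subrepresentation.toRepresentation, LinearMap.restrict_apply, this]
  obtain ⟨n, σ, ⟨e⟩⟩ := exists_equiv_fin S.toRepresentation
  refine ⟨n, σ, fun g => ?_⟩
  have h1 : LinearMap.trace k V (ρ g * P) = c * ∑ h, f h⁻¹ * ρ.character (g * h) := by
    simp only [P, mul_smul_comm, Finset.mul_sum, ← map_mul, map_sum, map_smul]
    rw [Finset.smul_sum]
    rfl
  rw [← char_iso e, hS, h1]
  have := character_convolution ι hf ρ g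
  simp only [c]
  field_simp
  linear_combination this

end Isotypic

/-! ### Schur index as multiplicity in a rational irreducible representation. -/

section SchurIndex

variable {G : Type*} [Group G] {V : Type*} [AddCommGroup V] [Module ℚ V]

lemma coe_character_fixed (ρ : Representation ℚ G V) (τ : ℂ →+* ℂ) :
    τ ∘ character ρ = character ρ := by
  ext g
  simp [character]

variable [Fintype G]

lemma mem_constituents_iff (ρ : Representation ℚ G V) {χ : G → ℂ} :
    χ ∈ constituents ρ ↔ χ ∈ Irr G ∧ pairing (character ρ) χ ≠ 0 :=
  and_congr_right fun h => by rw [charInner_eq_pairing _ h]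

lemma pairing_character_comp (ρ : Representation ℚ G V) (τ : ℂ →+* ℂ) (χ : G → ℂ) :
    pairing (character ρ) (τ ∘ χ) = τ (pairing (character ρ) χ) := by
  rw [map_pairing, coe_character_fixed]

variable [FiniteDimensional ℚ V]

lemma exists_pairing_character_eq_natCast (ρ : Representation ℚ G V) {χ : G → ℂ}
    (hχ : χ ∈ Irr G) : ∃ m : ℕ, pairing (character ρ) χ = m :=
  exists_pairing_eq_natCast (algebraMap ℚ ℂ) ρ hχ

/-- The function `χ` with values in the field generated by them. -/
def characterInField {G : Type*} (χ : G → ℂ) (g : G) : characterField χ :=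
  ⟨χ g, IntermediateField.subset_adjoin _ _ ⟨g, rfl⟩⟩

/-- The values of `χ` generate `ℚ(χ)`, so only the inclusion fixes them all. -/
lemma exists_comp_characterInField_eq_iff {G : Type*} (χ : G → ℂ) :
    ∃ ι : characterField χ →ₐ[ℚ] ℂ, ∀ σ : characterField χ →ₐ[ℚ] ℂ,
      σ ∘ characterInField χ = χ ↔ σ = ι := by
  refine ⟨(characterField χ).val, fun σ => ⟨fun h => ?_, ?_⟩⟩
  · refine IntermediateField.algHom_ext_of_eq_adjoin (F := ℚ) (E := ℂ) (K := ℂ)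
      (S := characterField χ) (s := Set.range χ) rfl ?_
    rintro _ ⟨g, rfl⟩
    exact congrFun h g
  · rintro rfl
    rfl

/-- If `m χ` is afforded by a representation over `ℚ(χ)` and `χ` is a constituent of the
irreducible rational representation `ρ`, then the multiplicity of `χ` in `ρ` is at most `m`, and
all constituents of `ρ` are conjugate to `χ`. -/
lemma multiplicity_le_and_conjugate {ρ : Representation ℚ G V} (hρ : ρ.IsIrreducible)
    {χ : G → ℂ} (hχ : χ ∈ Irr G) {m₀ : ℕ} (hm₀ : pairing (character ρ) χ = m₀) (hm₀' : m₀ ≠ 0)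
    {m n : ℕ} (hm : 0 < m) (U : Representation (characterField χ) G (Fin n → characterField χ))
    (hU : ∀ g, ((U.character g : characterField χ) : ℂ) = m * χ g) :
    m₀ ≤ m ∧ ∀ χ' ∈ constituents ρ, ∃ τ : ℂ →+* ℂ, χ' = τ ∘ χ := by
  have := finiteDimensional_characterField hχ
  have : FiniteDimensional ℚ (Fin n → characterField χ) := .trans ℚ (characterField χ) _
  obtain ⟨ι, hι⟩ := exists_comp_characterInField_eq_iff χ
  choose τ hτ using exists_ringHom_extending (characterField χ)
  have hστ (σ : characterField χ →ₐ[ℚ] ℂ) : σ ∘ characterInField χ = τ σ ∘ χ :=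
    funext fun g => (hτ σ _).symm
  let UQ := restrictScalars ℚ U
  -- Restriction of scalars replaces the character by its trace to `ℚ`, the sum over all embeddings.
  have hUQ : character UQ = (m : ℂ) • ∑ σ : characterField χ →ₐ[ℚ] ℂ, τ σ ∘ χ := by
    ext g
    have h1 : U.character g = m * characterInField χ g := Subtype.ext (by
      rw [hU]
      simp [characterInField])
    have h2 : character UQ g = algebraMap ℚ ℂ (UQ.character g) := rfl
    rw [h2, character_restrictScalars, trace_eq_sum_embeddings ℂ, h1, Pi.smul_apply,
      Finset.sum_apply, smul_eq_mul, Finset.mul_sum]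
    refine Finset.sum_congr rfl fun σ _ => ?_
    rw [map_mul, map_natCast, ← hστ]
    rfl
  have hne : pairing UQ.character ρ.character ≠ 0 := by
    intro h0
    have h1 := map_pairing (algebraMap ℚ ℂ) UQ.character ρ.character
    rw [h0, map_zero] at h1
    have h2 : pairing (character UQ) (character ρ) = 0 := h1.symm
    rw [hUQ, pairing_smul_left, pairing_sum_left] at h2
    simp_rw [pairing_comm _ (character ρ), pairing_character_comp, hm₀, map_natCast,
      Finset.sum_const, Finset.card_univ, nsmul_eq_mul] at h2
    norm_cast at h2
    have h3 : Fintype.card (characterField χ →ₐ[ℚ] ℂ) ≠ 0 :=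
      (Fintype.card_pos_iff.2 ⟨ι⟩).ne'
    exact mul_ne_zero hm.ne' (mul_ne_zero h3 hm₀') h2
  obtain ⟨T, ⟨e⟩⟩ := exists_prod_of_pairing_ne_zero hρ hne
  have hsum : character UQ = character ρ + character T.toRepresentation := by
    have h1 := char_iso e
    rw [character_prod] at h1
    ext g
    have h2 := congrArg (algebraMap ℚ ℂ) (congrFun h1 g)
    rw [Pi.add_apply, map_add] at h2
    exact h2.symm
  have key (χ' : G → ℂ) (hχ' : χ' ∈ Irr G) : ∃ t : ℕ,
      (m : ℂ) * ∑ σ : characterField χ →ₐ[ℚ] ℂ, pairing (τ σ ∘ χ) χ' =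
        pairing (character ρ) χ' + t := by
    obtain ⟨t, ht⟩ := exists_pairing_character_eq_natCast T.toRepresentation hχ'
    refine ⟨t, ?_⟩
    rw [← ht, ← pairing_add_left, ← hsum, hUQ, pairing_smul_left, pairing_sum_left]
  refine ⟨?_, fun χ' hχ' => ?_⟩
  · obtain ⟨t, ht⟩ := key χ hχ
    -- Only the inclusion contributes: any other embedding gives an irreducible character different
    -- from `χ`.
    have hone : ∑ σ : characterField χ →ₐ[ℚ] ℂ, pairing (τ σ ∘ χ) χ = 1 := by
      rw [Fintype.sum_eq_single ι, ← hστ,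
        (hι _).2 rfl, pairing_self_of_mem_irr hχ]
      refine fun σ hσ => pairing_eq_zero_of_mem_irr (comp_mem_irr _ hχ) hχ fun h => hσ ?_
      rwa [← hστ, hι] at h
    rw [hone, hm₀, mul_one] at ht
    norm_cast at ht
    omega
  · rw [mem_constituents_iff] at hχ'
    obtain ⟨t, ht⟩ := key χ' hχ'.1
    obtain ⟨m', hm'⟩ := exists_pairing_character_eq_natCast ρ hχ'.1
    by_contra! hcon
    rw [Finset.sum_eq_zero fun σ _ => pairing_eq_zero_of_mem_irr (comp_mem_irr _ hχ) hχ'.1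
      (hcon (τ σ)).symm, mul_zero, hm'] at ht
    norm_cast at ht
    have : m' = 0 := by omega
    exact hχ'.2 (by rw [hm', this, Nat.cast_zero])

lemma exists_isotypic_characterField (ρ : Representation ℚ G V) {χ : G → ℂ} (hχ : χ ∈ Irr G)
    {m : ℕ} (hm : pairing (character ρ) χ = m) :
    ∃ (n : ℕ) (U : Representation (characterField χ) G (Fin n → characterField χ)),
      ∀ g, ((U.character g : characterField χ) : ℂ) = m * χ g := by
  obtain ⟨n, ρ', hρ'⟩ := exists_character_eq_comp (algebraMap ℚ (characterField χ)) ρ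
  have hcomp : (algebraMap (characterField χ) ℂ) ∘ characterInField χ = χ := rfl
  obtain ⟨n', U, hU⟩ := exists_isotypic (algebraMap (characterField χ) ℂ)
    (f := characterInField χ) (hcomp ▸ hχ) ρ'
  refine ⟨n', U, fun g => ?_⟩
  have h1 : pairing ρ'.character (characterInField χ) = m := by
    apply (algebraMap (characterField χ) ℂ).injective
    rw [map_pairing, hρ', hcomp, map_natCast, ← hm]
    congr 1
  rw [hU, h1]
  simp [characterInField]

variable {ρ : Representation ℚ G V}

/-- The isotypic component over `ℚ(χ)` attains the multiplicity, and `multiplicity_le_and_conjugate`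
shows that nothing smaller occurs. -/
theorem pairing_character_eq_schurIndex (hρ : ρ.IsIrreducible) {χ : G → ℂ}
    (hχ : χ ∈ constituents ρ) : pairing (character ρ) χ = schurIndex χ := by
  rw [mem_constituents_iff] at hχ
  obtain ⟨m, hm⟩ := exists_pairing_character_eq_natCast ρ hχ.1
  have hm0 : m ≠ 0 := by
    rintro rfl
    exact hχ.2 (by rw [hm, Nat.cast_zero])
  have hleast : IsLeast {m : ℕ | 0 < m ∧ ∃ (n : ℕ)
      (σ : Representation (characterField χ) G (Fin n → characterField χ)),
      ∀ g : G, ((σ.character g : characterField χ) : ℂ) = m * χ g} m := by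
    refine ⟨⟨Nat.pos_of_ne_zero hm0, exists_isotypic_characterField ρ hχ.1 hm⟩, ?_⟩
    rintro m' ⟨hm', n, U, hU⟩
    exact (multiplicity_le_and_conjugate hρ hχ.1 hm hm0 hm' U hU).1
  rw [hm, schurIndex, hleast.csInf_eq]

theorem exists_conjugate (hρ : ρ.IsIrreducible) {χ χ' : G → ℂ} (hχ : χ ∈ constituents ρ)
    (hχ' : χ' ∈ constituents ρ) : ∃ τ : ℂ →+* ℂ, χ' = τ ∘ χ := by
  rw [mem_constituents_iff] at hχ
  obtain ⟨m, hm⟩ := exists_pairing_character_eq_natCast ρ hχ.1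
  have hm0 : m ≠ 0 := by
    rintro rfl
    exact hχ.2 (by rw [hm, Nat.cast_zero])
  obtain ⟨n, U, hU⟩ := exists_isotypic_characterField ρ hχ.1 hm
  exact (multiplicity_le_and_conjugate hρ hχ.1 hm hm0 (Nat.pos_of_ne_zero hm0) U hU).2 χ' hχ'

theorem pairing_character_eq_of_constituents (hρ : ρ.IsIrreducible) {χ χ' : G → ℂ}
    (hχ : χ ∈ constituents ρ) (hχ' : χ' ∈ constituents ρ) :
    pairing (character ρ) χ' = pairing (character ρ) χ := by
  obtain ⟨τ, rfl⟩ := exists_conjugate hρ hχ hχ'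
  rw [pairing_character_comp, pairing_character_eq_schurIndex hρ hχ, map_natCast]

lemma constituents_nonempty (hρ : ρ.IsIrreducible) : (constituents ρ).Nonempty := by
  obtain ⟨n, σ, hσ⟩ := exists_character_eq_comp (algebraMap ℚ ℂ) ρ
  obtain ⟨m, ψ, hψ, hsum⟩ := exists_character_eq_sum_irr σ
  by_contra hempty
  have h0 (i : Fin m) : pairing (character ρ) (ψ i) = 0 := by
    by_contra h0
    exact hempty ⟨ψ i, (mem_constituents_iff ρ).2 ⟨hψ i, h0⟩⟩
  have hself : pairing (character ρ) (character ρ) = 0 := by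
    have h1 : character ρ = ∑ i, ψ i := hσ.symm.trans hsum
    conv_lhs => arg 1; rw [h1]
    rw [pairing_sum_left]
    exact Finset.sum_eq_zero fun i _ => by rw [pairing_comm, h0]
  have := ((isIrreducible_iff _).1 hρ).1
  apply pairing_self_ne_zero ρ
  apply (algebraMap ℚ ℂ).injective
  rw [map_pairing, map_zero]
  exact hself

lemma moduleSchurIndex_eq (hρ : ρ.IsIrreducible) {χ : G → ℂ} (hχ : χ ∈ constituents ρ) :
    (moduleSchurIndex ρ : ℂ) = pairing (character ρ) χ := by
  have h := constituents_nonempty hρ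
  rw [moduleSchurIndex, dif_pos h, ← pairing_character_eq_schurIndex hρ h.some_mem,
    pairing_character_eq_of_constituents hρ h.some_mem hχ]

/-- Taking `c` an integer ensures that it is fixed by the ring endomorphisms relating the
constituents. -/
lemma hasIndicator_of_mem (hρ : ρ.IsIrreducible) {χ : G → ℂ} (hχ : χ ∈ constituents ρ) (c : ℤ)
    (h : frobeniusSchur χ = c) : HasIndicator ρ c := by
  refine ⟨⟨χ, hχ⟩, fun χ' hχ' => ?_⟩
  obtain ⟨τ, rfl⟩ := exists_conjugate hρ hχ hχ'
  rw [frobeniusSchur_comp, h, map_intCast]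

/-- An absolutely irreducible real `σ` has indicator `2 - 1 = 1`, so it cannot occur when the
indicator is `0` or `-1`; when it occurs, its multiplicity is the Schur index. -/
theorem hasEvenRealMultiplicities_iff (hρ : ρ.IsIrreducible) :
    HasEvenRealMultiplicities (fun g => algebraMap ℚ ℝ (LinearMap.trace ℚ V (ρ g))) ↔
      IsOfComplexType ρ ∨ IsOfQuaternionicType ρ ∨ Even (moduleSchurIndex ρ) := by
  have hcoe (φ : G → ℝ) : ((pairing (fun g => algebraMap ℚ ℝ (LinearMap.trace ℚ V (ρ g))) φ : ℝ) :
      ℂ) = pairing (character ρ) (fun g => (φ g : ℂ)) :=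
    map_pairing Complex.ofRealHom _ _
  constructor
  · intro h
    obtain ⟨χ, hχ⟩ := constituents_nonempty hρ
    rcases real_or_frobeniusSchur hχ.1 with ⟨n, σ, hσ, hσ1, hσχ⟩ | h0 | h1
    · right; right
      obtain ⟨k, hk⟩ := h n σ hσ hσ1
      have h2 := hcoe σ.character
      rw [hk, funext hσχ, ← moduleSchurIndex_eq hρ hχ] at h2
      refine ⟨k, ?_⟩
      rw [← two_mul]
      exact_mod_cast h2.symm
    · left
      have := hasIndicator_of_mem hρ hχ 0 (by simpa using h0)
      rwa [Int.cast_zero] at this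
    · right; left
      have := hasIndicator_of_mem hρ hχ (-1) (by simpa using h1)
      rwa [Int.cast_neg, Int.cast_one] at this
  · intro h n σ hσ hσ1
    have hnorm : pairing (fun g => (σ.character g : ℂ)) (fun g => (σ.character g : ℂ)) = 1 := by
      have := map_pairing Complex.ofRealHom σ.character σ.character
      rw [hσ1, map_one] at this
      exact this.symm
    have hirr : (fun g => (σ.character g : ℂ)) ∈ Irr G := by
      obtain ⟨m, σ', hσ'⟩ := exists_character_eq_comp Complex.ofRealHom σ
      have hσ'' : σ'.character = fun g => (σ.character g : ℂ) := hσ'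
      rw [← hσ''] at hnorm ⊢
      exact character_mem_irr (isIrreducible_of_pairing_self_eq_one σ' hnorm)
    have hfs := frobeniusSchur_of_real σ hσ
    rw [hnorm] at hfs
    by_cases h0 : pairing (fun g => algebraMap ℚ ℝ (LinearMap.trace ℚ V (ρ g))) σ.character = 0
    · exact ⟨0, by simpa using h0⟩
    have hmem : (fun g => (σ.character g : ℂ)) ∈ constituents ρ := by
      rw [mem_constituents_iff, ← hcoe]
      exact ⟨hirr, Complex.ofReal_ne_zero.2 h0⟩
    rcases h with h | h | h
    · have := h.2 _ hmem
      rw [hfs] at this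
      norm_num at this
    · have := h.2 _ hmem
      rw [hfs] at this
      norm_num at this
    · obtain ⟨k, hk⟩ := h
      refine ⟨k, ?_⟩
      have h1 := hcoe σ.character
      rw [← moduleSchurIndex_eq hρ hmem, hk, ← two_mul] at h1
      exact_mod_cast h1

end SchurIndex

/-! ### Essential complexity read off from the character. -/

section EssentiallyComplex

/-- A general base ring `K` lets the same criterion serve for the lattice and its rational span. -/
theorem isEssentiallyComplex_iff {K : Type*} [CommRing K] [Algebra K ℝ] {G : Type*} [Group G]
    [Fintype G] {V : Type*} [AddCommGroup V] [Module K V] [Module.Finite K V] [Module.Free K V]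
    (ρ : Representation K G V) :
    IsEssentiallyComplex ρ ↔
      HasEvenRealMultiplicities (fun g => algebraMap K ℝ (LinearMap.trace K V (ρ g))) := by
  have hχ : (baseChange ℝ ρ).character = fun g => algebraMap K ℝ (LinearMap.trace K V (ρ g)) :=
    funext fun g => LinearMap.trace_baseChange (ρ g) ℝ
  rw [← hχ]
  constructor
  · rintro ⟨J, hJ, hJ2⟩ n σ - -
    exact HasComplexStructure.exists_pairing_eq_two_mul ⟨J, hJ, hJ2⟩ σ
  · intro h
    obtain ⟨J, hJ, hJ2⟩ := hasComplexStructure_of_hasEvenRealMultiplicities _ _ rfl h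
    exact ⟨J, hJ, hJ2⟩

end EssentiallyComplex

end GLattice

theorem mainTheorem8 {G : Type*} [Group G] [Fintype G]
    {L : Type*} [AddCommGroup L] [Module.Finite ℤ L] [Module.Free ℤ L]
    (ρ : Representation ℤ G L) (hρ : GLattice.IsIrreducibleLattice ρ) :
    List.TFAE [
      GLattice.IsEssentiallyComplex ρ,
      GLattice.IsEssentiallyComplex (GLattice.baseChange ℚ ρ),
      GLattice.IsOfComplexType ρ ∨ GLattice.IsOfQuaternionicType ρ ∨
        Even (GLattice.latticeSchurIndex ρ)] := by
  have htr (g : G) : LinearMap.trace ℚ (TensorProduct ℤ ℚ L) (GLattice.baseChange ℚ ρ g) =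
      algebraMap ℤ ℚ (LinearMap.trace ℤ L (ρ g)) :=
    LinearMap.trace_baseChange (ρ g) ℚ
  have hchar : GLattice.character (GLattice.baseChange ℚ ρ) = GLattice.character ρ := by
    ext g
    simp [GLattice.character, htr]
  have hind (ε : ℂ) :
      GLattice.HasIndicator (GLattice.baseChange ℚ ρ) ε ↔ GLattice.HasIndicator ρ ε := by
    simp only [GLattice.HasIndicator, GLattice.constituents, hchar]
  tfae_have 1 ↔ 2 := by
    rw [GLattice.isEssentiallyComplex_iff, GLattice.isEssentiallyComplex_iff]
    simp [htr]
  tfae_have 2 ↔ 3 := by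
    rw [GLattice.isEssentiallyComplex_iff, GLattice.hasEvenRealMultiplicities_iff hρ]
    exact or_congr (hind 0) (or_congr (hind (-1)) Iff.rfl)
  tfae_finish
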